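/- Let $n\ge 1$, $m=\sum_{i=1}^n m_i$, $r=\sum_{i=1}^n r_i$, and let $A\in\mathbb R^{m\times m}$, $B\in\mathbb R^{r\times r}$, $C\in\mathbb R^{m\times r}$ be partitioned as $A=\mathrm{col}\{A_1,\dots,A_n\}$ with $A_i\in\mathbb R^{m_i\times m}$, $B=[B_1,\dots,B_n]$ with $B_i\in\mathbb R^{r\times r_i}$, and $C=[C_1,\dots,C_n]$ with $C_i\in\mathbb R^{m\times r_i}$. For $Y_i\in\mathbb R^{m_i\times q}$ let $[Y_i]_{\mathcal R}\in\mathbb R^{m\times q}$ be the matrix whose $i$-th block of rows is $Y_i$ and whose other rows are zero; for $Z_i\in\mathbb R^{q\times r_i}$ let $[Z_i]_{\mathcal C}\in\mathbb R^{q\times r}$ be the matrix whose $i$-th block of columns is $Z_i$ and whose other columns are zero; the same notation is used with the roles of $(m_i)$ and $(r_i)$ exchanged. Let $a_{i,j}=a_{j,i}\ge 0$ be the weights of an undirected graph on $\{1,\dots,n\}$ in which $i\neq j$ are adjacent exactly when $a_{i,j}>0$, and assume that this graph is connected. Let $\alpha>0$, let $g:\mathbb R^{m\times r}\to\mathbb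 R$ be convex with subdifferential $\partial g$, and assume that the function $$\Phi(X)=\tfrac12\|AX+XB-C\|_F^2+n\alpha\, g(X)$$ has a minimizer. Consider the differential inclusion, for $i=1,\dots,n$, $$\begin{aligned} \dot X_i&\in-(X_iB_i-C_i+Z_i)B_i^T-\alpha\,\partial g(X_i)-A_i^T\Upsilon_i-\sum_j a_{i,j}(\Lambda_i-\Lambda_j)-A_i^T(A_iX_i-Y_i)-\sum_j a_{i,j}(X_i-X_j),\\ \dot Y_i&=\Upsilon_i-[I_{m_i}]_{\mathcal C}\Theta_i+A_i(X_i-\dot X_i)-Y_i,\\ \dot Z_i&=-\big((X_i-\dot X_i)B_i-C_i+Z_i\big)+\Theta_i[I_{r_i}]_{\mathcal R},\\ \dot W_i&=\sum_j a_{i,j}(\Theta_i-\Theta_j),\\ \dot\Lambda_i&=\sum_j a_{i,j}(X_i-X_j+\dot X_i-\dot X_j),\\ \dot\Upsilon_i&=A_i(X_i+\dot X_i)-Y_i,\\ \dot\Theta_i&=[Y_i]_{\mathcal R}-[Z_i]_{\mathcal C}-\sum_j a_{i,j}(W_i-W_j)-\sum_j a_{i,j}(\Theta_i-\Theta_j),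 \end{aligned}$$ with state $P=(X_i,Y_i,Z_i,W_i,\Lambda_i,\Upsilon_i,\Theta_i)_{i=1}^n$, where $X_i,W_i,\Lambda_i,\Theta_i\in\mathbb R^{m\times r}$, $Y_i,\Upsilon_i\in\mathbb R^{m_i\times r}$, $Z_i\in\mathbb R^{m\times r_i}$, and where $\dot X_i$ on the right-hand sides is the velocity chosen in the first line. Write it as $\dot P\in\mathcal F(P)$. A solution is a function $P$ on $[0,\infty)$, absolutely continuous on bounded intervals, with $\dot P(t)\in\mathcal F(P(t))$ for almost every $t>0$; an equilibrium is a point $P^*$ with $0\in\mathcal F(P^*)$; it is Lyapunov stable if for every $\varepsilon>0$ there is $\delta>0$ such that every solution with $\|P(0)-P^*\|<\delta$ satisfies $\|P(t)-P^*\|<\varepsilon$ for all $t\ge0$. Then: (i) every equilibrium is Lyapunov stable, and every solution is bounded on $[0,\infty)$; (ii) the system is globally semi-stable: every solution converges, as $t\to\infty$, to a Lyapunov stable equilibrium; (iii) for every solution there is a minimizer $X^*$ of $\Phi$ such that $\lim_{t\to\infty}X_i(t)=X^*$ for every agent $i$. -/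

import Mathlib

open Set Filter Topology MeasureTheory

/- Real matrices carry the Frobenius norm. -/
attribute [local instance] Matrix.frobeniusNormedAddCommGroup Matrix.frobeniusNormedSpace

namespace DistSylvester

/-! ### Differential inclusions -/

section Inclusion

variable {E : Type*} [NormedAddCommGroup E] [NormedSpace ℝ E]

/-- `x` is a solution on `[0, ∞)` of the differential inclusion `ẋ(t) ∈ F (x(t))`: it is absolutely
continuous on every interval `[0, T]` and satisfies the inclusion for almost every `t > 0`. -/
def IsSolution (F : E → Set E) (x : ℝ → E) : Prop :=
  (∀ T : ℝ, 0 < T → AbsolutelyContinuousOnInterval x 0 T) ∧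
    ∀ᵐ t ∂(volume.restrict (Ioi (0 : ℝ))), ∃ v ∈ F (x t), HasDerivAt x v t

/-- `z` is an equilibrium of `ẋ ∈ F (x)` when `0 ∈ F z`. -/
def IsEquilibrium (F : E → Set E) (z : E) : Prop := (0 : E) ∈ F z

/-- `z` is a Lyapunov stable equilibrium of `ẋ ∈ F (x)`. -/
def IsLyapunovStable (F : E → Set E) (z : E) : Prop :=
  IsEquilibrium F z ∧
    ∀ ε : ℝ, 0 < ε → ∃ δ : ℝ, 0 < δ ∧
      ∀ x : ℝ → E, IsSolution F x → ‖x 0 - z‖ < δ → ∀ t : ℝ, 0 ≤ t → ‖x t - z‖ < ε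

/-- Every solution starting in `D` converges to a Lyapunov stable equilibrium. -/
def IsSemistableOn (F : E → Set E) (D : Set E) : Prop :=
  ∀ x : ℝ → E, IsSolution F x → x 0 ∈ D →
    ∃ z : E, IsLyapunovStable F z ∧ Tendsto x atTop (𝓝 z)

/-- Global semi-stability: semi-stability with respect to the whole space. -/
def IsGloballySemistable (F : E → Set E) : Prop := IsSemistableOn F univ

end Inclusion

/-! ### Convex penalties -/

/-- The Frobenius inner product. -/
def frobInner {κ ι : Type*} [Fintype κ] [Fintype ι] (M N : Matrix κ ι ℝ) : ℝ :=
  ∑ p, ∑ q, M p q * N p q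

/-- The subdifferential at `X₀` of a real-valued function of a matrix. -/
def subdiff {κ ι : Type*} [Fintype κ] [Fintype ι] (g : Matrix κ ι ℝ → ℝ) (X₀ : Matrix κ ι ℝ) :
    Set (Matrix κ ι ℝ) :=
  {h | ∀ X, g X₀ + frobInner h (X - X₀) ≤ g X}

/-! ### Block partitions -/

section Blocks

variable {n : ℕ} {κ : Type*}

/-- `∑ i, s i` indices, split into `n` consecutive blocks, the `i`-th one of length `s i`. -/
abbrev Idx (s : Fin n → ℕ) : Type := (i : Fin n) × Fin (s i)

/-- The `i`-th block of rows. -/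
def rowBlock {s : Fin n → ℕ} (i : Fin n) (M : Matrix (Idx s) κ ℝ) : Matrix (Fin (s i)) κ ℝ :=
  fun k q => M ⟨i, k⟩ q

/-- The `i`-th block of columns. -/
def colBlock {s : Fin n → ℕ} (i : Fin n) (M : Matrix κ (Idx s) ℝ) : Matrix κ (Fin (s i)) ℝ :=
  fun p k => M p ⟨i, k⟩

/-- The matrix whose `i`-th block of rows is `M` and whose other rows vanish. -/
def rowPad {s : Fin n → ℕ} (i : Fin n) (M : Matrix (Fin (s i)) κ ℝ) : Matrix (Idx s) κ ℝ :=
  fun p q => if h : p.1 = i then M (h ▸ p.2) q else 0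

/-- The matrix whose `i`-th block of columns is `M` and whose other columns vanish. -/
def colPad {s : Fin n → ℕ} (i : Fin n) (M : Matrix κ (Fin (s i)) ℝ) : Matrix κ (Idx s) ℝ :=
  fun p q => if h : q.1 = i then M p (h ▸ q.2) else 0

end Blocks

/-! ### The network and the algorithm -/

section Algorithm

variable {n : ℕ} {m r : Fin n → ℕ}

/-- `a` is the weighted adjacency matrix of an undirected graph. -/
structure IsUndirectedWeight (a : Matrix (Fin n) (Fin n) ℝ) : Prop where
  symm : ∀ i j, a i j = a j i
  nonneg : ∀ i j, 0 ≤ a i j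

/-- The graph with an edge between `i ≠ j` exactly when the weight is positive. -/
def weightGraph (a : Matrix (Fin n) (Fin n) ℝ) : SimpleGraph (Fin n) :=
  SimpleGraph.fromRel fun i j => 0 < a i j

/-- `∑ j, a i j (U i - U j)`. -/
def disagreement {κ ι : Type*} (a : Matrix (Fin n) (Fin n) ℝ) (U : Fin n → Matrix κ ι ℝ)
    (i : Fin n) : Matrix κ ι ℝ :=
  ∑ j, a i j • (U i - U j)

/-- The states `(X, Y, Z, W, Λ, Υ, Θ)` of all agents. -/
abbrev State (m r : Fin n → ℕ) : Type :=
  (Fin n → Matrix (Idx m) (Idx r) ℝ) ×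
  ((i : Fin n) → Matrix (Fin (m i)) (Idx r) ℝ) ×
  ((i : Fin n) → Matrix (Idx m) (Fin (r i)) ℝ) ×
  (Fin n → Matrix (Idx m) (Idx r) ℝ) ×
  (Fin n → Matrix (Idx m) (Idx r) ℝ) ×
  ((i : Fin n) → Matrix (Fin (m i)) (Idx r) ℝ) ×
  (Fin n → Matrix (Idx m) (Idx r) ℝ)

namespace State

/-- The estimates `X i`. -/
def X (P : State m r) : Fin n → Matrix (Idx m) (Idx r) ℝ := P.1

/-- The estimates `Y i`. -/
def Y (P : State m r) : (i : Fin n) → Matrix (Fin (m i)) (Idx r) ℝ := P.2.1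

/-- The estimates `Z i`. -/
def Z (P : State m r) : (i : Fin n) → Matrix (Idx m) (Fin (r i)) ℝ := P.2.2.1

/-- The estimates `W i`. -/
def W (P : State m r) : Fin n → Matrix (Idx m) (Idx r) ℝ := P.2.2.2.1

/-- The multipliers `Λ i`. -/
def lam (P : State m r) : Fin n → Matrix (Idx m) (Idx r) ℝ := P.2.2.2.2.1

/-- The multipliers `Υ i`. -/
def ups (P : State m r) : (i : Fin n) → Matrix (Fin (m i)) (Idx r) ℝ := P.2.2.2.2.2.1

/-- The multipliers `Θ i`. -/
def theta (P : State m r) : Fin n → Matrix (Idx m) (Idx r) ℝ := P.2.2.2.2.2.2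

end State

/-- The set-valued right-hand side of the algorithm: `V` is an admissible velocity at `P`. The
derivative feedback terms are those that contain `State.X V`, the velocity of `X`. -/
def regField (A : Matrix (Idx m) (Idx m) ℝ) (B : Matrix (Idx r) (Idx r) ℝ)
    (C : Matrix (Idx m) (Idx r) ℝ) (a : Matrix (Fin n) (Fin n) ℝ) (α : ℝ)
    (g : Matrix (Idx m) (Idx r) ℝ → ℝ) (P : State m r) : Set (State m r) :=
  {V | ∀ i : Fin n,
    (∃ h ∈ subdiff g (State.X P i),
      State.X V i =
        -((State.X P i * colBlock i B - colBlock i C + State.Z P i) * (colBlock i B).transpose)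
        - α • h - (rowBlock i A).transpose * State.ups P i
        - disagreement a (State.lam P) i
        - (rowBlock i A).transpose * (rowBlock i A * State.X P i - State.Y P i)
        - disagreement a (State.X P) i) ∧
    State.Y V i =
      State.ups P i - colPad i (1 : Matrix (Fin (m i)) (Fin (m i)) ℝ) * State.theta P i
        + rowBlock i A * (State.X P i - State.X V i) - State.Y P i ∧
    State.Z V i =
      -((State.X P i - State.X V i) * colBlock i B - colBlock i C + State.Z P i)
        + State.theta P i * rowPad i (1 : Matrix (Fin (r i)) (Fin (r i)) ℝ) ∧
    State.W V i = disagreement a (State.theta P) i ∧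
    State.lam V i = disagreement a (State.X P) i + disagreement a (State.X V) i ∧
    State.ups V i = rowBlock i A * (State.X P i + State.X V i) - State.Y P i ∧
    State.theta V i =
      rowPad i (State.Y P i) - colPad i (State.Z P i) - disagreement a (State.W P) i
        - disagreement a (State.theta P) i}

/-- The regularized objective `½ ‖A X + X B - C‖² + β g(X)`, with the Frobenius norm. -/
noncomputable def regObjective (A : Matrix (Idx m) (Idx m) ℝ) (B : Matrix (Idx r) (Idx r) ℝ)
    (C : Matrix (Idx m) (Idx r) ℝ) (β : ℝ) (g : Matrix (Idx m) (Idx r) ℝ → ℝ)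
    (X : Matrix (Idx m) (Idx r) ℝ) : ℝ :=
  1 / 2 * ‖A * X + X * B - C‖ ^ 2 + β * g X

end Algorithm

end DistSylvester

open DistSylvester

/-! With the blocks collected into linear operators (`sylvesterOperators`), the algorithm is a
saddle-point flow with derivative feedback, `SaddleOperators.field`. Moving an equilibrium to the
origin and subtracting from the penalty an affine minorant there gives a flow of the same shape with
`c = 0` and a convex `G ≥ 0 = G 0` (`exists_field_recentre`). Along it, half the sum of the
quadratic forms of all seven state components and of `B x`, `A x` and `⟨x, L x⟩`, plus `G x`,
decreases at rate at least `|B x + z|² + |A x - y|² + ⟨x, L x⟩ + ⟨θ, L θ⟩ + |x'|²`. Indeed the terms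
linear in `x'` add up to `-|x'|²` by the first equation, and the leftover `⟨η, x⟩` is nonnegative
because `η` is a subgradient (`energy_balance`, `hasDerivAt_energy`). This yields stability and
boundedness.

For convergence, the set-valued velocity of `x` is avoided in favour of Barbalat-type arguments. The
dissipation makes `x` slowly varying and drives the dissipated quantities other than `x'` to zero.
The residuals that are not dissipated vanish because a bounded curve cannot keep drifting in a
slowly varying direction (`settles`). Since `x'` is small at arbitrarily late times, some limit
point is an equilibrium, by closedness of the graph of the subdifferential
(`exists_equilibrium_limit_point`). Recentred at this very equilibrium, the monotone energy tends to
zero along a sequence, hence along the whole trajectory (`exists_tendsto_equilibrium`).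

Equilibria encode the optimality conditions of `Φ`. Consensus makes all `X i` and all `Θ i` equal,
the `Θ i` being the residual `A X + X B - C`, and summing the first equation over the agents removes
the Laplacian terms and leaves stationarity (`exists_isMinOn_of_isEquilibrium`). Conversely, a
minimizer extends to an equilibrium because the Laplacian of a connected graph reaches every
zero-sum family (`exists_isEquilibrium`). -/

set_option linter.unusedSectionVars false

/-! ### Calculus of absolutely continuous curves. -/

section RayCalculus

variable {E F : Type*} [NormedAddCommGroup E] [NormedSpace ℝ E] [NormedAddCommGroup F]
  [NormedSpace ℝ F]

/-- The curve has compact image, on which local Lipschitz continuity becomes uniform. This makes the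
energy absolutely continuous although `G` is merely convex. -/
theorem AbsolutelyContinuousOnInterval.comp_locallyLipschitz {φ : E → F} {f : ℝ → E} {a b : ℝ}
    (hφ : LocallyLipschitz φ) (hf : AbsolutelyContinuousOnInterval f a b) :
    AbsolutelyContinuousOnInterval (fun t => φ (f t)) a b := by
  have hc : IsCompact (f '' uIcc a b) := isCompact_uIcc.image_of_continuousOn hf.continuousOn
  obtain ⟨K, hK⟩ := LocallyLipschitzOn.exists_lipschitzOnWith_of_compact hc hφ.locallyLipschitzOn
  rw [absolutelyContinuousOnInterval_iff] at hf ⊢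
  intro ε hε
  obtain ⟨δ, hδ, h⟩ := hf (ε / (K + 1)) (by positivity)
  refine ⟨δ, hδ, fun I hI hlen => ?_⟩
  calc ∑ i ∈ Finset.range I.1, dist (φ (f (I.2 i).1)) (φ (f (I.2 i).2))
      ≤ ∑ i ∈ Finset.range I.1, K * dist (f (I.2 i).1) (f (I.2 i).2) :=
        Finset.sum_le_sum fun i hi => hK.dist_le_mul _ (mem_image_of_mem f (hI.1 i hi).1) _
          (mem_image_of_mem f (hI.1 i hi).2)
    _ = K * ∑ i ∈ Finset.range I.1, dist (f (I.2 i).1) (f (I.2 i).2) := by rw [Finset.mul_sum]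
    _ ≤ K * (ε / (K + 1)) := by gcongr; exact (h I hI hlen).le
    _ < (K + 1) * (ε / (K + 1)) := by gcongr; linarith
    _ = ε := by field_simp

theorem AbsolutelyContinuousOnInterval.le_of_ae_deriv_nonneg {ψ : ℝ → ℝ} {a b : ℝ} (hab : a ≤ b)
    (hψ : AbsolutelyContinuousOnInterval ψ a b)
    (hd : ∀ᵐ t, t ∈ Ioo a b → ∃ ψ', HasDerivAt ψ ψ' t ∧ 0 ≤ ψ') : ψ a ≤ ψ b := by
  have h := hψ.integral_deriv_eq_sub
  have h2 : 0 ≤ ∫ x in a..b, deriv ψ x := by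
    apply intervalIntegral.integral_nonneg_of_ae_restrict hab
    rw [Filter.EventuallyLE, ae_restrict_iff' measurableSet_Icc]
    have hb : ∀ᵐ t : ℝ, t ≠ a ∧ t ≠ b := by
      have h1 : ∀ᵐ t : ℝ, t ≠ a := by simp [ae_iff, measure_singleton]
      have h2 : ∀ᵐ t : ℝ, t ≠ b := by simp [ae_iff, measure_singleton]
      exact h1.and h2
    filter_upwards [hd, hb] with t ht htn hmem
    obtain ⟨ψ', h1, h2⟩ := ht ⟨lt_of_le_of_ne hmem.1 htn.1.symm, lt_of_le_of_ne hmem.2 htn.2⟩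
    simpa [h1.deriv] using h2
  linarith

/-- Absolute continuity on every bounded interval of `[0, ∞)`. -/
def AbsolutelyContinuousOnRay (f : ℝ → E) : Prop :=
  ∀ T : ℝ, 0 < T → AbsolutelyContinuousOnInterval f 0 T

namespace AbsolutelyContinuousOnRay

theorem interval {f : ℝ → E} (hf : AbsolutelyContinuousOnRay f) {a b : ℝ} (ha : 0 ≤ a)
    (hab : a ≤ b) : AbsolutelyContinuousOnInterval f a b := by
  refine (hf (b + 1) (by linarith)).mono ?_
  rw [uIcc_of_le hab, uIcc_of_le (by linarith)]
  exact Icc_subset_Icc ha (by linarith)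

theorem comp_locallyLipschitz {f : ℝ → E} (hf : AbsolutelyContinuousOnRay f) {φ : E → F}
    (hφ : LocallyLipschitz φ) : AbsolutelyContinuousOnRay fun t => φ (f t) :=
  fun T hT => (hf T hT).comp_locallyLipschitz hφ

theorem clm {f : ℝ → E} (hf : AbsolutelyContinuousOnRay f) (φ : E →L[ℝ] F) :
    AbsolutelyContinuousOnRay fun t => φ (f t) :=
  hf.comp_locallyLipschitz φ.lipschitz.locallyLipschitz

theorem add {f g : ℝ → E} (hf : AbsolutelyContinuousOnRay f) (hg : AbsolutelyContinuousOnRay g) :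
    AbsolutelyContinuousOnRay fun t => f t + g t :=
  fun T hT => (hf T hT).fun_add (hg T hT)

theorem sub {f g : ℝ → E} (hf : AbsolutelyContinuousOnRay f) (hg : AbsolutelyContinuousOnRay g) :
    AbsolutelyContinuousOnRay fun t => f t - g t :=
  fun T hT => (hf T hT).fun_sub (hg T hT)

theorem linear (c : E) : AbsolutelyContinuousOnRay fun t : ℝ => t • c := by
  intro T _
  exact ((((ContinuousLinearMap.id ℝ ℝ).smulRight c).lipschitz).lipschitzOnWith
    (s := uIcc 0 T)).absolutelyContinuousOnInterval

theorem le_of_ae_deriv {ψ : ℝ → ℝ} (hψ : AbsolutelyContinuousOnRay ψ) {a b : ℝ} (ha : 0 ≤ a)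
    (hab : a ≤ b)
    (hd : ∀ᵐ t ∂volume.restrict (Ioi (0 : ℝ)), t ∈ Ioo a b → ∃ ψ', HasDerivAt ψ ψ' t ∧ 0 ≤ ψ') :
    ψ a ≤ ψ b := by
  refine (hψ.interval ha hab).le_of_ae_deriv_nonneg hab ?_
  rw [ae_restrict_iff' measurableSet_Ioi] at hd
  filter_upwards [hd] with t ht hmem
  exact ht (lt_of_le_of_lt ha hmem.1) hmem

/-- A vector-valued mean value inequality. -/
theorem norm_sub_le {f : ℝ → E} {φ : ℝ → ℝ} (hf : AbsolutelyContinuousOnRay f)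
    (hφ : AbsolutelyContinuousOnRay φ) {a b : ℝ} (ha : 0 ≤ a) (hab : a ≤ b)
    (hd : ∀ᵐ t ∂volume.restrict (Ioi (0 : ℝ)), t ∈ Ioo a b →
      ∃ f' φ', HasDerivAt f f' t ∧ HasDerivAt φ φ' t ∧ ‖f'‖ ≤ φ') :
    ‖f b - f a‖ ≤ φ b - φ a := by
  -- A functional norming the increment reduces the claim to monotonicity of the scalar `φ - ℓ ∘ f`.
  obtain ⟨ℓ, hℓ, hℓ2⟩ := exists_dual_vector'' ℝ (f b - f a)
  have h := (hφ.sub (hf.clm ℓ)).le_of_ae_deriv ha hab ?_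
  · have : ℓ (f b - f a) = ‖f b - f a‖ := by simpa using hℓ2
    rw [map_sub] at this
    linarith
  filter_upwards [hd] with t ht hmem
  obtain ⟨f', φ', h1, h2, h3⟩ := ht hmem
  refine ⟨_, h2.sub (ℓ.hasFDerivAt.comp_hasDerivAt t h1), ?_⟩
  have := ℓ.le_opNorm f'
  have h4 : ℓ f' ≤ ‖ℓ f'‖ := le_abs_self _
  have h5 : ‖ℓ‖ * ‖f'‖ ≤ 1 * ‖f'‖ := by gcongr
  linarith

theorem norm_sub_le_mul {f : ℝ → E} (hf : AbsolutelyContinuousOnRay f) {C : ℝ} {a b : ℝ}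
    (ha : 0 ≤ a) (hab : a ≤ b)
    (hd : ∀ᵐ t ∂volume.restrict (Ioi (0 : ℝ)), t ∈ Ioo a b → ∃ f', HasDerivAt f f' t ∧ ‖f'‖ ≤ C) :
    ‖f b - f a‖ ≤ C * (b - a) := by
  have h := hf.norm_sub_le (linear C) ha hab ?_
  · simpa [mul_sub, mul_comm] using h
  filter_upwards [hd] with t ht hmem
  obtain ⟨f', h1, h2⟩ := ht hmem
  refine ⟨f', C, h1, ?_, h2⟩
  simpa using (hasDerivAt_id t).smul_const C

end AbsolutelyContinuousOnRay

/-! ### Slowly varying functions and Barbalat-type lemmas. -/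

/-- On windows of bounded length, the oscillation of `f` vanishes asymptotically. -/
def IsSlowlyVarying (f : ℝ → E) : Prop :=
  ∀ T : ℝ, 0 < T → ∀ ε : ℝ, 0 < ε →
    ∀ᶠ t in atTop, ∀ s ∈ Icc (0 : ℝ) T, ‖f (t + s) - f t‖ ≤ ε

namespace IsSlowlyVarying

theorem add {f g : ℝ → E} (hf : IsSlowlyVarying f) (hg : IsSlowlyVarying g) :
    IsSlowlyVarying fun t => f t + g t := by
  intro T hT ε hε
  filter_upwards [hf T hT (ε / 2) (by positivity), hg T hT (ε / 2) (by positivity)]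
    with t h1 h2 s hs
  calc _ = ‖(f (t + s) - f t) + (g (t + s) - g t)‖ := by congr 1; abel
    _ ≤ ε / 2 + ε / 2 := (norm_add_le _ _).trans (add_le_add (h1 s hs) (h2 s hs))
    _ = ε := by ring

theorem clm {f : ℝ → E} (hf : IsSlowlyVarying f) (φ : E →L[ℝ] F) :
    IsSlowlyVarying fun t => φ (f t) := by
  intro T hT ε hε
  filter_upwards [hf T hT (ε / (‖φ‖ + 1)) (by positivity)] with t h s hs
  rw [← map_sub]
  calc _ ≤ ‖φ‖ * ‖f (t + s) - f t‖ := φ.le_opNorm _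
    _ ≤ (‖φ‖ + 1) * (ε / (‖φ‖ + 1)) := by
      gcongr
      · linarith
      · exact h s hs
    _ = ε := by field_simp

theorem neg {f : ℝ → E} (hf : IsSlowlyVarying f) : IsSlowlyVarying fun t => -f t :=
  hf.clm (-ContinuousLinearMap.id ℝ E)

theorem sub {f g : ℝ → E} (hf : IsSlowlyVarying f) (hg : IsSlowlyVarying g) :
    IsSlowlyVarying fun t => f t - g t := by
  simpa only [sub_eq_add_neg] using hf.add hg.neg

theorem of_tendsto_zero {f : ℝ → E} (hf : Tendsto f atTop (𝓝 0)) : IsSlowlyVarying f := by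
  intro T hT ε hε
  have h := (tendsto_zero_iff_norm_tendsto_zero.1 hf).eventually (ge_mem_nhds (half_pos hε))
  obtain ⟨t₀, ht₀⟩ := eventually_atTop.1 h
  filter_upwards [eventually_ge_atTop t₀] with t ht s hs
  have h1 := ht₀ t ht
  have h2 := ht₀ (t + s) (by linarith [hs.1])
  linarith [norm_sub_le (f (t + s)) (f t)]

theorem of_deriv_tendsto_zero {f : ℝ → E} (hf : AbsolutelyContinuousOnRay f) {r : ℝ → ℝ}
    (hr : Tendsto r atTop (𝓝 0))
    (hd : ∀ᵐ t ∂volume.restrict (Ioi (0 : ℝ)), ∃ f', HasDerivAt f f' t ∧ ‖f'‖ ≤ r t) :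
    IsSlowlyVarying f := by
  intro T hT ε hε
  obtain ⟨t₀, ht₀⟩ := eventually_atTop.1 (hr.eventually (ge_mem_nhds (div_pos hε hT)))
  filter_upwards [eventually_ge_atTop t₀, eventually_ge_atTop 0] with t ht ht' s hs
  have h := hf.norm_sub_le_mul (C := ε / T) ht' (b := t + s) (by linarith [hs.1]) ?_
  · refine h.trans ?_
    rw [add_sub_cancel_left]
    calc ε / T * s ≤ ε / T * T := by gcongr; exact hs.2
      _ = ε := by field_simp
  filter_upwards [hd] with τ hτ hmem
  obtain ⟨f', h1, h2⟩ := hτ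
  exact ⟨f', h1, h2.trans (ht₀ τ (ht.trans hmem.1.le))⟩

/-- A function whose squared speed is dominated by the decay rate of a convergent function. -/
theorem of_sq_deriv_le {f : ℝ → E} (hf : AbsolutelyContinuousOnRay f) {v : ℝ → ℝ}
    (hv : AbsolutelyContinuousOnRay v) {ℓ : ℝ} (hℓ : Tendsto v atTop (𝓝 ℓ))
    (hd : ∀ᵐ t ∂volume.restrict (Ioi (0 : ℝ)),
      ∃ f' v', HasDerivAt f f' t ∧ HasDerivAt v v' t ∧ ‖f'‖ ^ 2 ≤ -v') :
    IsSlowlyVarying f := by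
  intro T hT ε hε
  -- From `‖f'‖ ≤ δ + ‖f'‖² / δ ≤ δ - v' / δ`, the increment over a window is at most `δ T` plus the
  -- drop of `v` divided by `δ`. This `δ` makes the first term `ε / 2`; the second is small late
  -- because `v` converges.
  set δ : ℝ := ε / (2 * T) with hδ
  have hδ0 : 0 < δ := by positivity
  have hball : ∀ᶠ t in atTop, |v t - ℓ| ≤ δ * ε / 4 := by
    have := (tendsto_zero_iff_norm_tendsto_zero.1 (tendsto_sub_nhds_zero_iff.2 hℓ)).eventually
      (ge_mem_nhds (show 0 < δ * ε / 4 by positivity))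
    simpa using this
  obtain ⟨t₀, ht₀⟩ := eventually_atTop.1 hball
  filter_upwards [eventually_ge_atTop t₀, eventually_ge_atTop 0] with t ht ht' s hs
  have h := hf.norm_sub_le ((AbsolutelyContinuousOnRay.linear δ).sub
    (hv.clm (δ⁻¹ • ContinuousLinearMap.id ℝ ℝ))) ht' (b := t + s) (by linarith [hs.1]) ?_
  · refine h.trans ?_
    have h1 := abs_le.1 (ht₀ t ht)
    have h2 := abs_le.1 (ht₀ (t + s) (by linarith [hs.1]))
    have h3 : δ⁻¹ * (v t - v (t + s)) ≤ δ⁻¹ * (δ * ε / 2) := by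
      gcongr
      linarith
    have h4 : δ⁻¹ * (δ * ε / 2) = ε / 2 := by field_simp
    have h5 : s * δ ≤ T * δ := by gcongr; exact hs.2
    have h6 : T * δ = ε / 2 := by rw [hδ]; field_simp
    simp only [smul_eq_mul, smul_apply, ContinuousLinearMap.id_apply]
    linarith
  filter_upwards [hd] with τ hτ _
  obtain ⟨f', v', h1, h2, h3⟩ := hτ
  refine ⟨f', _, h1, (((hasDerivAt_id τ).smul_const δ).sub (h2.const_smul δ⁻¹)), ?_⟩
  simp only [smul_eq_mul]
  have h4 : ‖f'‖ * δ ≤ δ * δ + ‖f'‖ ^ 2 := by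
    nlinarith [sq_nonneg (‖f'‖ - δ), sq_nonneg (‖f'‖ + δ)]
  have h5 : ‖f'‖ = δ⁻¹ * (‖f'‖ * δ) := by field_simp
  rw [h5]
  calc δ⁻¹ * (‖f'‖ * δ) ≤ δ⁻¹ * (δ * δ + -v') := by gcongr; linarith
    _ = _ := by field_simp; ring

end IsSlowlyVarying

/-- A bounded function cannot keep drifting in a slowly varying direction. -/
theorem tendsto_zero_of_bounded_of_slow_drift {f p : ℝ → E} (hf : AbsolutelyContinuousOnRay f)
    {M : ℝ} (hM : ∀ t, 0 ≤ t → ‖f t‖ ≤ M) (hp : IsSlowlyVarying p) {r : ℝ → ℝ}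
    (hr : Tendsto r atTop (𝓝 0))
    (hd : ∀ᵐ t ∂volume.restrict (Ioi (0 : ℝ)), ∃ f', HasDerivAt f f' t ∧ ‖f' - p t‖ ≤ r t) :
    Tendsto p atTop (𝓝 0) := by
  rw [Metric.tendsto_nhds]
  intro ε hε
  have hM0 : 0 ≤ M := (norm_nonneg _).trans (hM 0 le_rfl)
  -- Over a window of length `T` the curve moves by `T • p t` up to `T ε / 2`, yet by at most `2 M`.
  -- Here `2 M < T ε / 4`, so `‖p t‖ < ε`.
  set T : ℝ := 8 * M / ε + 1 with hT
  have hT0 : 0 < T := by positivity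
  obtain ⟨t₀, ht₀⟩ := eventually_atTop.1 (hr.eventually
    (ge_mem_nhds (show 0 < ε / 4 by positivity)))
  filter_upwards [eventually_ge_atTop t₀, eventually_ge_atTop 0, hp T hT0 (ε / 4) (by positivity)]
    with t ht ht' hpt
  have h := (hf.sub (AbsolutelyContinuousOnRay.linear (p t))).norm_sub_le_mul (C := ε / 2) ht'
    (b := t + T) (by linarith) ?_
  · have h1 : T * ‖p t‖ ≤ 2 * M + ε / 2 * T := by
      have h2 := hM t ht'
      have h3 := hM (t + T) (by linarith)
      calc T * ‖p t‖ = ‖T • p t‖ := by rw [norm_smul, Real.norm_of_nonneg hT0.le]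
        _ = ‖f (t + T) - f t - (f (t + T) - (t + T) • p t - (f t - t • p t))‖ := by
          congr 1; module
        _ ≤ (‖f (t + T)‖ + ‖f t‖) + ε / 2 * (t + T - t) :=
          (norm_sub_le _ _).trans (add_le_add (norm_sub_le _ _) h)
        _ ≤ _ := by linarith [add_sub_cancel_left t T, show ε / 2 * (t + T - t) = ε / 2 * T by ring]
    have h2 : 8 * M + ε = T * ε := by rw [hT]; field_simp
    rw [dist_zero_right]
    by_contra hcon
    push Not at hcon
    have := mul_le_mul_of_nonneg_left hcon hT0.le
    nlinarith
  filter_upwards [hd] with τ hτ hmem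
  obtain ⟨f', h1, h2⟩ := hτ
  refine ⟨_, h1.sub ((hasDerivAt_id τ).smul_const (p t)), ?_⟩
  have h3 := hpt (τ - t) ⟨by linarith [hmem.1], by linarith [hmem.2]⟩
  rw [add_sub_cancel] at h3
  have h4 := ht₀ τ (ht.trans hmem.1.le)
  calc _ = ‖(f' - p τ) + (p τ - p t)‖ := by congr 1; simp
    _ ≤ ε / 4 + ε / 4 := (norm_add_le _ _).trans (add_le_add (h2.trans h4) h3)
    _ = ε / 2 := by ring

/-- A form of Barbalat's lemma. -/
theorem tendsto_zero_of_sq_le_decay {u : ℝ → E} {v : ℝ → ℝ} (hv : AbsolutelyContinuousOnRay v)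
    {ℓ κ K : ℝ} (hℓ : Tendsto v atTop (𝓝 ℓ)) (hκ : 0 < κ) (hK : 0 ≤ K)
    (hu : ∀ ε : ℝ, 0 < ε → ∀ᶠ t in atTop, ∀ s ∈ Icc (0 : ℝ) 1, ‖u (t + s) - u t‖ ≤ K * s + ε)
    (hd : ∀ᵐ t ∂volume.restrict (Ioi (0 : ℝ)), ∃ v', HasDerivAt v v' t ∧ κ * ‖u t‖ ^ 2 ≤ -v') :
    Tendsto u atTop (𝓝 0) := by
  rw [Metric.tendsto_nhds]
  intro ε hε
  -- If `‖u t‖ ≥ ε`, then `‖u‖ ≥ ε / 2` on a window of length `τ`, where `v` must drop by `κ (ε /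
  -- 2)² τ`. Late in time this exceeds what the convergence of `v` allows.
  set τ : ℝ := min 1 (ε / (4 * (K + 1))) with hτ
  have hτ0 : 0 < τ := by positivity
  have hKτ : K * τ ≤ ε / 4 := by
    calc K * τ ≤ (K + 1) * (ε / (4 * (K + 1))) := by
          gcongr
          · linarith
          · exact min_le_right _ _
      _ = ε / 4 := by field_simp
  have hη : 0 < κ * (ε / 2) ^ 2 * τ / 4 := by positivity
  have hball : ∀ᶠ t in atTop, |v t - ℓ| ≤ κ * (ε / 2) ^ 2 * τ / 4 := by
    have := (tendsto_zero_iff_norm_tendsto_zero.1 (tendsto_sub_nhds_zero_iff.2 hℓ)).eventually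
      (ge_mem_nhds hη)
    simpa using this
  obtain ⟨t₀, ht₀⟩ := eventually_atTop.1 hball
  filter_upwards [eventually_ge_atTop t₀, eventually_ge_atTop 0, hu (ε / 4) (by positivity)]
    with t ht ht' hut
  rw [dist_zero_right]
  by_contra hcon
  push Not at hcon
  have h := ((AbsolutelyContinuousOnRay.linear (-(κ * (ε / 2) ^ 2))).sub hv).le_of_ae_deriv ht'
    (b := t + τ) (by linarith) ?_
  · have h1 := abs_le.1 (ht₀ t ht)
    have h2 := abs_le.1 (ht₀ (t + τ) (by linarith))
    simp only [smul_eq_mul] at h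
    have h3 : (t + τ) * -(κ * (ε / 2) ^ 2) - t * -(κ * (ε / 2) ^ 2) = -(κ * (ε / 2) ^ 2 * τ) := by
      ring
    linarith
  filter_upwards [hd] with σ hσ hmem
  obtain ⟨v', h1, h2⟩ := hσ
  refine ⟨_, ((hasDerivAt_id σ).smul_const _).sub h1, ?_⟩
  have h3 := hut (σ - t) ⟨by linarith [hmem.1],
    by linarith [hmem.2, min_le_left 1 (ε / (4 * (K + 1)))]⟩
  rw [add_sub_cancel] at h3
  have h4 : K * (σ - t) ≤ K * τ := by
    gcongr
    linarith [hmem.2]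
  have h5 : ε / 2 ≤ ‖u σ‖ := by
    have := norm_sub_norm_le (u t) (u σ)
    rw [norm_sub_rev] at this
    linarith
  have h6 : κ * (ε / 2) ^ 2 ≤ κ * ‖u σ‖ ^ 2 := by gcongr
  simp only [one_smul]
  linarith

end RayCalculus

/-! ### Energy forms and subgradients. -/

/-- A symmetric bilinear form whose quadratic form dominates the squared norm. -/
class EnergyForm (X : Type*) [NormedAddCommGroup X] [NormedSpace ℝ X] where
  form : X →L[ℝ] X →L[ℝ] ℝ
  form_comm : ∀ x y, form x y = form y x
  sq_norm_le : ∀ x, ‖x‖ ^ 2 ≤ form x x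

open EnergyForm

section Subgradient

variable {X : Type*} [NormedAddCommGroup X] [NormedSpace ℝ X] [EnergyForm X]

theorem form_self_nonneg (x : X) : 0 ≤ form x x := (sq_nonneg _).trans (sq_norm_le x)

/-- The subdifferential with respect to an energy form. -/
def formSubdiff (G : X → ℝ) (x : X) : Set X := {η | ∀ x', G x + form η (x' - x) ≤ G x'}

/-- The chain rule along a curve through a point where a subgradient is known. -/
theorem hasDerivAt_of_mem_formSubdiff {G : X → ℝ} {x : ℝ → X} {x' η : X} {t : ℝ}
    (hη : η ∈ formSubdiff G (x t)) (hx : HasDerivAt x x' t)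
    (hG : DifferentiableAt ℝ (fun s => G (x s)) t) :
    HasDerivAt (fun s => G (x s)) (form η x') t := by
  have h1 := hG.hasDerivAt.sub ((form η).hasFDerivAt.comp_hasDerivAt t hx)
  -- The subgradient inequality says that `G - form η` along the curve is minimal at time `t`, so
  -- its derivative vanishes there. No regularity of `η` in time is needed.
  have hmin : IsLocalMin ((fun s => G (x s)) - (fun s => form η (x s))) t := by
    refine Filter.Eventually.of_forall fun s => ?_
    have := hη (x s)
    rw [map_sub] at this
    simp only [Pi.sub_apply]
    linarith
  have h2 := hmin.hasDerivAt_eq_zero h1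
  have h3 : deriv (fun s => G (x s)) t = form η x' := by linarith
  rw [← h3]
  exact hG.hasDerivAt

/-- Subtracting an affine minorant and recentring. -/
noncomputable def recentre (G : X → ℝ) (x₀ η₀ : X) (x : X) : ℝ := G (x + x₀) - G x₀ - form η₀ x

theorem mem_formSubdiff_recentre {G : X → ℝ} {x₀ η₀ x η : X} :
    η ∈ formSubdiff (recentre G x₀ η₀) x ↔ η + η₀ ∈ formSubdiff G (x + x₀) := by
  simp only [formSubdiff, recentre, mem_ofPred_eq]
  constructor
  · intro h x'
    have := h (x' - x₀)
    simp only [map_sub, map_add, add_apply, sub_add_cancel] at this ⊢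
    linarith
  · intro h x'
    have := h (x' + x₀)
    simp only [map_sub, map_add, add_apply] at this ⊢
    linarith

theorem convexOn_recentre {G : X → ℝ} (hG : ConvexOn ℝ univ G) (x₀ η₀ : X) :
    ConvexOn ℝ univ (recentre G x₀ η₀) := by
  have h1 : ConvexOn ℝ univ fun x => G (x + x₀) := by
    simpa [Function.comp_def] using hG.translate_left x₀
  have h2 : ConcaveOn ℝ univ fun x => form η₀ x := (form η₀).toLinearMap.concaveOn convex_univ
  exact ((h1.add_const (-G x₀)).sub h2).congr fun x _ => by
    simp [recentre, sub_eq_add_neg]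

theorem recentre_nonneg {G : X → ℝ} {x₀ η₀ : X} (h : η₀ ∈ formSubdiff G x₀) (x : X) :
    0 ≤ recentre G x₀ η₀ x := by
  have := h (x + x₀)
  rw [add_sub_cancel_right] at this
  simp only [recentre]
  linarith

theorem recentre_zero (G : X → ℝ) (x₀ η₀ : X) : recentre G x₀ η₀ 0 = 0 := by simp [recentre]

theorem mem_formSubdiff_of_tendsto {G : X → ℝ} (hG : Continuous G) {x η : ℕ → X} {x₀ η₀ : X}
    (hx : Tendsto x atTop (𝓝 x₀)) (hη : Tendsto η atTop (𝓝 η₀))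
    (h : ∀ k, η k ∈ formSubdiff G (x k)) : η₀ ∈ formSubdiff G x₀ := by
  intro x'
  have h1 : Tendsto (fun k => G (x k) + form (η k) (x' - x k)) atTop
      (𝓝 (G x₀ + form η₀ (x' - x₀))) :=
    ((hG.tendsto x₀).comp hx).add (((form (X := X)).continuous₂.tendsto (η₀, x' - x₀)).comp
      (hη.prodMk_nhds (tendsto_const_nhds.sub hx)))
  exact le_of_tendsto h1 (Filter.Eventually.of_forall fun k => h k x')

end Subgradient

/-! ### The abstract saddle-point flow and its energy balance. -/

/-- The linear operators of a consensus saddle-point flow, with their adjoints. -/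
structure SaddleOperators (X Y Z : Type*) [NormedAddCommGroup X] [NormedSpace ℝ X] [EnergyForm X]
    [NormedAddCommGroup Y] [NormedSpace ℝ Y] [EnergyForm Y] [NormedAddCommGroup Z]
    [NormedSpace ℝ Z] [EnergyForm Z] where
  A : X →L[ℝ] Y
  A' : Y →L[ℝ] X
  form_A : ∀ x y, form (A x) y = form x (A' y)
  B : X →L[ℝ] Z
  B' : Z →L[ℝ] X
  form_B : ∀ x z, form (B x) z = form x (B' z)
  R : X →L[ℝ] Y
  R' : Y →L[ℝ] X
  form_R : ∀ x y, form (R x) y = form x (R' y)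
  S : X →L[ℝ] Z
  S' : Z →L[ℝ] X
  form_S : ∀ x z, form (S x) z = form x (S' z)
  L : X →L[ℝ] X
  form_L : ∀ x y, form (L x) y = form x (L y)
  form_L_nonneg : ∀ x, 0 ≤ form x (L x)

namespace SaddleOperators

variable {X Y Z : Type*} [NormedAddCommGroup X] [NormedSpace ℝ X] [EnergyForm X]
    [NormedAddCommGroup Y] [NormedSpace ℝ Y] [EnergyForm Y] [NormedAddCommGroup Z]
    [NormedSpace ℝ Z] [EnergyForm Z] (O : SaddleOperators X Y Z)

/-- The right-hand side of the flow; the state is `(x, y, z, w, lam, ups, theta)`. -/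
def field (c : Z) (G : X → ℝ) : X × Y × Z × X × X × Y × X → Set (X × Y × Z × X × X × Y × X)
  | (x, y, z, w, l, u, θ) => {V | ∃ η ∈ formSubdiff G x,
    V.1 = -O.B' (O.B x - c + z) - η - O.A' u - O.L l - O.A' (O.A x - y) - O.L x ∧
    V.2.1 = u - O.R θ + O.A (x - V.1) - y ∧
    V.2.2.1 = -(O.B (x - V.1) - c + z) + O.S θ ∧
    V.2.2.2.1 = O.L θ ∧
    V.2.2.2.2.1 = O.L x + O.L V.1 ∧
    V.2.2.2.2.2.1 = O.A (x + V.1) - y ∧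
    V.2.2.2.2.2.2 = O.R' y - O.S' z - O.L w - O.L θ}

/-- The quadratic part of the energy. -/
noncomputable def quad : X × Y × Z × X × X × Y × X → ℝ
  | (x, y, z, w, l, u, θ) => 1 / 2 * (form x x + form y y + form z z + form w w + form l l
      + form u u + form θ θ + form (O.B x) (O.B x) + form (O.A x) (O.A x) + form x (O.L x))

theorem contDiff_quad : ContDiff ℝ 1 O.quad := by
  unfold quad
  have h (W : Type _) [NormedAddCommGroup W] [NormedSpace ℝ W] [EnergyForm W]
    (f g : X × Y × Z × X × X × Y × X → W) (hf : ContDiff ℝ 1 f) (hg : ContDiff ℝ 1 g) :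
    ContDiff ℝ 1 fun P => form (f P) (g P) :=
    ((form (X := W)).contDiff.comp hf).clm_apply hg
  fun_prop

/-- The product carries the sup norm, so each component is bounded separately by its own term of
`quad`; the remaining terms are nonnegative. -/
theorem half_sq_norm_le_quad (P : X × Y × Z × X × X × Y × X) : 1 / 2 * ‖P‖ ^ 2 ≤ O.quad P := by
  obtain ⟨x, y, z, w, l, u, θ⟩ := P
  have hx := sq_norm_le x
  have hy := sq_norm_le y
  have hz := sq_norm_le z
  have hw := sq_norm_le w
  have hl := sq_norm_le l
  have hu := sq_norm_le u
  have hθ := sq_norm_le θ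
  have h1 := form_self_nonneg (O.B x)
  have h2 := form_self_nonneg (O.A x)
  have h3 := O.form_L_nonneg x
  have key : ‖(x, y, z, w, l, u, θ)‖ ≤ √(2 * O.quad (x, y, z, w, l, u, θ)) := by
    simp only [norm_prod_le_iff]
    refine ⟨?_, ?_, ?_, ?_, ?_, ?_, ?_⟩ <;>
    · apply Real.le_sqrt_of_sq_le
      simp only [quad]
      linarith [sq_nonneg ‖x‖, sq_nonneg ‖y‖, sq_nonneg ‖z‖, sq_nonneg ‖w‖, sq_nonneg ‖l‖,
        sq_nonneg ‖u‖, sq_nonneg ‖θ‖]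
  have := pow_le_pow_left₀ (norm_nonneg _) key 2
  rw [Real.sq_sqrt] at this
  · linarith
  simp only [quad]
  linarith [sq_nonneg ‖x‖, sq_nonneg ‖y‖, sq_nonneg ‖z‖, sq_nonneg ‖w‖, sq_nonneg ‖l‖,
    sq_nonneg ‖u‖, sq_nonneg ‖θ‖]

/-- The rate at which the energy is dissipated, up to a nonnegative term. -/
noncomputable def dissipation (v : X) : X × Y × Z × X × X × Y × X → ℝ
  | (x, y, z, _, _, _, θ) => form (O.B x + z) (O.B x + z) + form (O.A x - y) (O.A x - y)
      + form x (O.L x) + form θ (O.L θ) + form v v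

theorem dissipation_nonneg (v : X) (P : X × Y × Z × X × X × Y × X) : 0 ≤ O.dissipation v P := by
  obtain ⟨x, y, z, w, l, u, θ⟩ := P
  have h1 := form_self_nonneg (O.B x + z)
  have h2 := form_self_nonneg (O.A x - y)
  have h3 := O.form_L_nonneg x
  have h4 := O.form_L_nonneg θ
  have h5 := form_self_nonneg v
  simp only [dissipation]
  linarith

theorem hasDerivAt_form {W : Type*} [NormedAddCommGroup W] [NormedSpace ℝ W] [EnergyForm W]
    {f g : ℝ → W} {f' g' : W} {t : ℝ} (hf : HasDerivAt f f' t) (hg : HasDerivAt g g' t) :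
    HasDerivAt (fun s => form (f s) (g s)) (form f' (g t) + form (f t) g') t :=
  ((form (X := W)).hasFDerivAt.comp_hasDerivAt t hf).clm_apply hg

theorem hasDerivAt_quad {P : ℝ → X × Y × Z × X × X × Y × X} {x : X} {y : Y} {z : Z} {w l : X}
    {u : Y} {θ : X} {x' : X} {y' : Y} {z' : Z} {w' l' : X}
    {u' : Y} {θ' : X} {t : ℝ} (hP : P t = (x, y, z, w, l, u, θ))
    (h : HasDerivAt P (x', y', z', w', l', u', θ') t) :
    HasDerivAt (fun s => O.quad (P s)) (form x x' + form y y' + form z z' + form w w' + form l l'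
      + form u u' + form θ θ' + form (O.B x) (O.B x') + form (O.A x) (O.A x')
      + form (O.L x) x') t := by
  have hx : HasDerivAt (fun s => (P s).1) x' t := h.fst
  have hy : HasDerivAt (fun s => (P s).2.1) y' t := h.snd.fst
  have hz : HasDerivAt (fun s => (P s).2.2.1) z' t := h.snd.snd.fst
  have hw : HasDerivAt (fun s => (P s).2.2.2.1) w' t := h.snd.snd.snd.fst
  have hl : HasDerivAt (fun s => (P s).2.2.2.2.1) l' t := h.snd.snd.snd.snd.fst
  have hu : HasDerivAt (fun s => (P s).2.2.2.2.2.1) u' t := h.snd.snd.snd.snd.snd.fst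
  have hθ : HasDerivAt (fun s => (P s).2.2.2.2.2.2) θ' t := h.snd.snd.snd.snd.snd.snd
  have hB := O.B.hasFDerivAt.comp_hasDerivAt t hx
  have hA := O.A.hasFDerivAt.comp_hasDerivAt t hx
  have hL := O.L.hasFDerivAt.comp_hasDerivAt t hx
  have := (((((((((((hasDerivAt_form hx hx).add (hasDerivAt_form hy hy)).add
    (hasDerivAt_form hz hz)).add (hasDerivAt_form hw hw)).add (hasDerivAt_form hl hl)).add
    (hasDerivAt_form hu hu)).add (hasDerivAt_form hθ hθ)).add (hasDerivAt_form hB hB)).add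
    (hasDerivAt_form hA hA)).add (hasDerivAt_form hx hL)).const_mul (1 / 2 : ℝ))
  refine this.congr_deriv ?_
  simp only [hP, Function.comp]
  rw [form_comm x' x, form_comm y' y, form_comm z' z, form_comm w' w, form_comm l' l,
    form_comm u' u, form_comm θ' θ, form_comm (O.B x') (O.B x), form_comm (O.A x') (O.A x),
    ← O.form_L x x', form_comm x' (O.L x)]
  ring

/-- The energy balance of the flow. -/
theorem energy_balance {G : X → ℝ} {x : X} {y : Y} {z : Z} {w l : X}
    {u : Y} {θ : X} {x' : X} {y' : Y} {z' : Z} {w' l' : X} {u' : Y} {θ' : X}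
    (h : (x', y', z', w', l', u', θ') ∈ O.field 0 G (x, y, z, w, l, u, θ)) :
    ∃ η ∈ formSubdiff G x, form x x' + form y y' + form z z' + form w w' + form l l'
      + form u u' + form θ θ' + form (O.B x) (O.B x') + form (O.A x) (O.A x') + form (O.L x) x'
      + form η x' = -(O.dissipation x' (x, y, z, w, l, u, θ) + form η x) := by
  obtain ⟨η, hη, h1, h2, h3, h4, h5, h6, h7⟩ := h
  refine ⟨η, hη, ?_⟩
  simp only at h1 h2 h3 h4 h5 h6 h7
  have e1 := congrArg (fun v => form x v) h1
  -- Pairing the first equation with `x'` collects the terms linear in `x'`, including those from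
  -- `|A x|²`, `|B x|²`, `⟨x, L x⟩` and `G`, into `-|x'|²`. Pairing it with `x` supplies the rest of
  -- the dissipation.
  have e1' := congrArg (fun v => form x' v) h1
  subst h2 h3 h4 h5 h6 h7
  simp only [map_sub, map_add, map_neg, sub_zero, ← O.form_A, ← O.form_B, ← O.form_R, ← O.form_S,
    ← O.form_L, dissipation, add_apply, sub_apply] at e1 e1' ⊢
  have c1 := form_comm (O.B x) z
  have c2 := form_comm (O.A x) y
  have c3 := form_comm (O.B x') z
  have c4 := form_comm (O.A x') y
  have c5 := form_comm (O.B x') (O.B x)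
  have c6 := form_comm (O.A x') (O.A x)
  have c7 := form_comm x' η
  have c8 := form_comm x η
  have c9 := form_comm (O.A x) u
  have c10 := form_comm (O.A x') u
  have c11 := form_comm (O.R θ) y
  have c12 := form_comm (O.S θ) z
  have c13 := (form_comm (O.L l) x).trans (O.form_L x l).symm
  have c14 := (form_comm (O.L l) x').trans (O.form_L x' l).symm
  have c15 := (form_comm (O.L w) θ).trans (O.form_L θ w).symm
  have c16 := (form_comm (O.L x) x').trans (O.form_L x' x).symm
  have c17 := form_comm y u
  linarith

end SaddleOperators

/-- Splits the dissipated quantity into a slowly varying part and a Lipschitz part, so that the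
quantity itself need not have a bounded derivative. -/
theorem tendsto_zero_of_sq_le_decay_of_slow_add {E : Type*} [NormedAddCommGroup E] [NormedSpace ℝ E]
    {f g : ℝ → E} {v : ℝ → ℝ} (hv : AbsolutelyContinuousOnRay v)
    {ℓ κ K : ℝ} (hℓ : Tendsto v atTop (𝓝 ℓ)) (hκ : 0 < κ) (hg : IsSlowlyVarying g)
    (hf : AbsolutelyContinuousOnRay f) (hK : 0 ≤ K)
    (hf' : ∀ᵐ t ∂volume.restrict (Ioi (0 : ℝ)), ∃ f', HasDerivAt f f' t ∧ ‖f'‖ ≤ K)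
    (hd : ∀ᵐ t ∂volume.restrict (Ioi (0 : ℝ)),
      ∃ v', HasDerivAt v v' t ∧ κ * ‖g t + f t‖ ^ 2 ≤ -v') :
    Tendsto (fun t => g t + f t) atTop (𝓝 0) := by
  refine tendsto_zero_of_sq_le_decay hv hℓ hκ hK (fun ε hε => ?_) hd
  filter_upwards [hg 1 one_pos ε hε, eventually_ge_atTop 0] with t ht ht' s hs
  have h1 := hf.norm_sub_le_mul (b := t + s) ht' (by linarith [hs.1]) (hf'.mono fun _ h _ => h)
  rw [add_sub_cancel_left] at h1
  calc _ = ‖(f (t + s) - f t) + (g (t + s) - g t)‖ := by congr 1; abel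
    _ ≤ K * s + ε := (norm_add_le _ _).trans (add_le_add h1 (ht s hs))

/-! ### Convergence of the recentred flow. -/

namespace SaddleOperators

variable {X Y Z : Type*} [NormedAddCommGroup X] [NormedSpace ℝ X] [EnergyForm X]
    [NormedAddCommGroup Y] [NormedSpace ℝ Y] [EnergyForm Y] [NormedAddCommGroup Z]
    [NormedSpace ℝ Z] [EnergyForm Z] (O : SaddleOperators X Y Z)

/-- For a positive semidefinite `L` this follows by testing nonnegativity at `x - C⁻¹ L x`, with `C`
bounding the form of `L`. It converts the dissipation `⟨x, L x⟩` into decay of `L x`. -/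
theorem exists_sq_norm_L_le : ∃ κ : ℝ, 0 < κ ∧ ∀ x, κ * ‖O.L x‖ ^ 2 ≤ form x (O.L x) := by
  set C : ℝ := ‖form (X := X)‖ * ‖O.L‖ + 1 with hC
  have hC0 : 0 < C := by positivity
  refine ⟨C⁻¹, by positivity, fun x => ?_⟩
  set y := O.L x with hy
  have h1 := O.form_L_nonneg (x - C⁻¹ • y)
  have h2 : form y (O.L y) ≤ C * ‖y‖ ^ 2 := by
    have ha := (form (X := X)).le_opNorm₂ y (O.L y)
    have hb := O.L.le_opNorm y
    calc form y (O.L y) ≤ ‖form y (O.L y)‖ := le_abs_self _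
      _ ≤ ‖form (X := X)‖ * ‖y‖ * (‖O.L‖ * ‖y‖) := ha.trans (by gcongr)
      _ = (C - 1) * ‖y‖ ^ 2 := by rw [hC]; ring
      _ ≤ C * ‖y‖ ^ 2 := by gcongr; linarith
  have h3 := sq_norm_le y
  have h4 : form x (O.L y) = form y y := by rw [← O.form_L]
  simp only [map_sub, map_smul, sub_apply, smul_apply, smul_eq_mul, ← hy, h4] at h1
  have h5 : C⁻¹ * (C⁻¹ * form y (O.L y)) ≤ C⁻¹ * (C⁻¹ * (C * form y y)) := by
    gcongr
    exact h2.trans (by gcongr)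
  have h6 : C⁻¹ * (C⁻¹ * (C * form y y)) = C⁻¹ * form y y := by field_simp
  have h7 : C⁻¹ * ‖y‖ ^ 2 ≤ C⁻¹ * form y y := by gcongr
  linarith

section Homogeneous

variable [FiniteDimensional ℝ X] [FiniteDimensional ℝ Y] [FiniteDimensional ℝ Z]

/-- The energy of a state. -/
noncomputable def energy (G : X → ℝ) (P : X × Y × Z × X × X × Y × X) : ℝ := O.quad P + G P.1

variable {O} {G : X → ℝ} {P : ℝ → X × Y × Z × X × X × Y × X}

theorem energy_nonneg (hG0 : ∀ x, 0 ≤ G x) (Q : X × Y × Z × X × X × Y × X) : 0 ≤ O.energy G Q := by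
  have := O.half_sq_norm_le_quad Q
  have h2 := hG0 Q.1
  have := sq_nonneg ‖Q‖
  simp only [energy]
  linarith

theorem sq_norm_le_energy (hG0 : ∀ x, 0 ≤ G x) (Q : X × Y × Z × X × X × Y × X) :
    ‖Q‖ ^ 2 ≤ 2 * O.energy G Q := by
  have := O.half_sq_norm_le_quad Q
  have h2 := hG0 Q.1
  simp only [energy]
  linarith

theorem continuous_energy (hG : ConvexOn ℝ univ G) : Continuous (O.energy G) :=
  O.contDiff_quad.continuous.add (hG.locallyLipschitz.continuous.comp continuous_fst)

theorem energy_zero (hG00 : G 0 = 0) : O.energy G 0 = 0 := by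
  simp [energy, hG00, quad, ← Prod.mk_zero_zero]

theorem absolutelyContinuousOnRay_energy (hG : ConvexOn ℝ univ G)
    (hP : AbsolutelyContinuousOnRay P) : AbsolutelyContinuousOnRay fun t => O.energy G (P t) :=
  (hP.comp_locallyLipschitz O.contDiff_quad.locallyLipschitz).add
    ((hP.clm (ContinuousLinearMap.fst ℝ X _)).comp_locallyLipschitz hG.locallyLipschitz)

/-- The balance leaves `-⟨η, x⟩`, and comparing the subgradient `η` with the point `0` gives `⟨η, x⟩
≥ G x - G 0 ≥ 0`. -/
theorem hasDerivAt_energy (hG0 : ∀ x, 0 ≤ G x) (hG00 : G 0 = 0)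
    {t : ℝ} {V : X × Y × Z × X × X × Y × X}
    (hV : V ∈ O.field 0 G (P t)) (hPV : HasDerivAt P V t)
    (hE : DifferentiableAt ℝ (fun s => O.energy G (P s)) t) :
    ∃ e', HasDerivAt (fun s => O.energy G (P s)) e' t ∧ O.dissipation V.1 (P t) ≤ -e' := by
  obtain ⟨x', y', z', w', l', u', θ'⟩ := V
  obtain ⟨x, y, z, w, l, u, θ, hPt⟩ : ∃ x y z w l u θ, P t = (x, y, z, w, l, u, θ) :=
    ⟨_, _, _, _, _, _, _, rfl⟩
  rw [hPt] at hV ⊢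
  obtain ⟨η, hη, hbal⟩ := O.energy_balance hV
  have hq := O.hasDerivAt_quad hPt hPV
  have hGd : DifferentiableAt ℝ (fun s => G (P s).1) t := by
    have := hE.sub hq.differentiableAt
    refine this.congr_of_eventuallyEq (Filter.Eventually.of_forall fun s => ?_)
    simp [energy]
  have hx : HasDerivAt (fun s => (P s).1) x' t := hPV.fst
  have hη' : η ∈ formSubdiff G (P t).1 := by rw [hPt]; exact hη
  have hg := hasDerivAt_of_mem_formSubdiff hη' hx hGd
  refine ⟨_, hq.add hg, ?_⟩
  rw [hbal, neg_neg]
  have h1 := hη 0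
  have h2 := hG0 x
  rw [hG00, zero_sub, map_neg] at h1
  linarith

theorem ae_energy_decay (hG : ConvexOn ℝ univ G) (hG0 : ∀ x, 0 ≤ G x) (hG00 : G 0 = 0)
    (hP : IsSolution (O.field 0 G) P) :
    ∀ᵐ t ∂volume.restrict (Ioi (0 : ℝ)), ∃ V ∈ O.field 0 G (P t), HasDerivAt P V t ∧
      ∃ e', HasDerivAt (fun s => O.energy G (P s)) e' t ∧ O.dissipation V.1 (P t) ≤ -e' := by
  have hac := absolutelyContinuousOnRay_energy (O := O) hG hP.1
  have hd : ∀ᵐ t ∂volume.restrict (Ioi (0 : ℝ)),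
      DifferentiableAt ℝ (fun s => O.energy G (P s)) t := by
    rw [ae_restrict_iff' measurableSet_Ioi]
    have h1 : ∀ᵐ t : ℝ, ∀ k : ℕ, t ∈ uIcc (0 : ℝ) (k + 1) →
        DifferentiableAt ℝ (fun s => O.energy G (P s)) t :=
      ae_all_iff.2 fun k => (hac (k + 1) (by positivity)).ae_differentiableAt
    filter_upwards [h1] with t ht hpos
    obtain ⟨k, hk⟩ := exists_nat_ge t
    refine ht k ?_
    rw [uIcc_of_le (by positivity)]
    exact ⟨le_of_lt hpos, by linarith⟩
  filter_upwards [hP.2, hd] with t ⟨V, hV, hPV⟩ hdt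
  exact ⟨V, hV, hPV, hasDerivAt_energy hG0 hG00 hV hPV hdt⟩

theorem energy_antitone (hG : ConvexOn ℝ univ G) (hG0 : ∀ x, 0 ≤ G x) (hG00 : G 0 = 0)
    (hP : IsSolution (O.field 0 G) P) {s t : ℝ} (hs : 0 ≤ s) (hst : s ≤ t) :
    O.energy G (P t) ≤ O.energy G (P s) := by
  have hac := absolutelyContinuousOnRay_energy (O := O) hG hP.1
  have h := (hac.clm (-ContinuousLinearMap.id ℝ ℝ)).le_of_ae_deriv hs hst ?_
  · simpa using h
  filter_upwards [ae_energy_decay hG hG0 hG00 hP] with τ ⟨V, _, _, e', h1, h2⟩ _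
  refine ⟨-e', ?_, ?_⟩
  · simpa using h1.fun_neg
  · exact (O.dissipation_nonneg _ _).trans h2

theorem exists_tendsto_energy (hG : ConvexOn ℝ univ G) (hG0 : ∀ x, 0 ≤ G x) (hG00 : G 0 = 0)
    (hP : IsSolution (O.field 0 G) P) :
    ∃ ℓ, Tendsto (fun t => O.energy G (P t)) atTop (𝓝 ℓ) := by
  -- Clamping time at `0` gives a function monotone on all of `ℝ`, although the solution is
  -- controlled only on the half-line.
  have h1 : Antitone fun t : ℝ => O.energy G (P (max t 0)) := fun s t hst =>
    energy_antitone hG hG0 hG00 hP (le_max_right _ _) (max_le_max_right 0 hst)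
  have h2 : BddBelow (range fun t : ℝ => O.energy G (P (max t 0))) :=
    ⟨0, by rintro _ ⟨t, rfl⟩; exact energy_nonneg hG0 _⟩
  refine ⟨_, (tendsto_atTop_ciInf h1 h2).congr' ?_⟩
  filter_upwards [eventually_ge_atTop 0] with t ht
  rw [max_eq_left ht]

theorem exists_norm_le (hG : ConvexOn ℝ univ G) (hG0 : ∀ x, 0 ≤ G x) (hG00 : G 0 = 0)
    (hP : IsSolution (O.field 0 G) P) : ∃ M, ∀ t, 0 ≤ t → ‖P t‖ ≤ M := by
  refine ⟨√(2 * O.energy G (P 0)), fun t ht => Real.le_sqrt_of_sq_le ?_⟩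
  have := energy_antitone hG hG0 hG00 hP le_rfl ht
  linarith [sq_norm_le_energy (O := O) hG0 (P t)]

/-- The quantities that vanish at equilibria converge to zero along solutions. -/
structure Settles (O : SaddleOperators X Y Z) (P : ℝ → X × Y × Z × X × X × Y × X) : Prop where
  row : Tendsto (fun t => O.A (P t).1 - (P t).2.1) atTop (𝓝 0)
  col : Tendsto (fun t => O.B (P t).1 + (P t).2.2.1) atTop (𝓝 0)
  consensus : Tendsto (fun t => O.L (P t).1) atTop (𝓝 0)
  dual_consensus : Tendsto (fun t => O.L (P t).2.2.2.2.2.2) atTop (𝓝 0)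
  balance : Tendsto (fun t => O.R' (P t).2.1 - O.S' (P t).2.2.1 - O.L (P t).2.2.2.1) atTop (𝓝 0)
  dual_row : Tendsto (fun t => (P t).2.2.2.2.2.1 - O.R (P t).2.2.2.2.2.2) atTop (𝓝 0)
  dual_col : Tendsto (fun t => O.S (P t).2.2.2.2.2.2) atTop (𝓝 0)

theorem exists_norm_comp_le {W : Type*} [NormedAddCommGroup W]
    (hP : ∃ M, ∀ t, 0 ≤ t → ‖P t‖ ≤ M) (ψ : X × Y × Z × X × X × Y × X → W)
    (hψ : Continuous ψ) : ∃ K, 0 ≤ K ∧ ∀ t, 0 ≤ t → ‖ψ (P t)‖ ≤ K := by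
  obtain ⟨M, hM⟩ := hP
  obtain ⟨K, hK⟩ := (isCompact_closedBall (0 : X × Y × Z × X × X × Y × X)
    M).exists_bound_of_continuousOn hψ.continuousOn
  have h (t : ℝ) (ht : 0 ≤ t) : ‖ψ (P t)‖ ≤ K := hK _ (by simpa using hM t ht)
  exact ⟨K, (norm_nonneg _).trans (h 0 le_rfl), h⟩

/-- The order matters: dissipated quantities first, then slow variation of the other variables, and
last the residuals that only act as drifts of bounded curves. -/
theorem settles (hG : ConvexOn ℝ univ G) (hG0 : ∀ x, 0 ≤ G x) (hG00 : G 0 = 0)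
    (hP : IsSolution (O.field 0 G) P) : Settles O P := by
  have hM := exists_norm_le hG hG0 hG00 hP
  obtain ⟨ℓ, hℓ⟩ := exists_tendsto_energy hG hG0 hG00 hP
  obtain ⟨κ, hκ, hL⟩ := O.exists_sq_norm_L_le
  have hE := absolutelyContinuousOnRay_energy (O := O) hG hP.1
  have hdec := ae_energy_decay hG hG0 hG00 hP
  have hpos : ∀ᵐ t ∂volume.restrict (Ioi (0 : ℝ)), 0 < t := ae_restrict_mem measurableSet_Ioi
  set x : ℝ → X := fun t => (P t).1 with hx
  set y : ℝ → Y := fun t => (P t).2.1 with hy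
  set z : ℝ → Z := fun t => (P t).2.2.1 with hz
  set w : ℝ → X := fun t => (P t).2.2.2.1 with hw
  set u : ℝ → Y := fun t => (P t).2.2.2.2.2.1 with hu
  set θ : ℝ → X := fun t => (P t).2.2.2.2.2.2 with hθ
  have hax : AbsolutelyContinuousOnRay x := AbsolutelyContinuousOnRay.clm hP.1 (.fst ℝ X _)
  have h2 : AbsolutelyContinuousOnRay fun t => (P t).2 :=
    AbsolutelyContinuousOnRay.clm hP.1 (.snd ℝ X _)
  have hay : AbsolutelyContinuousOnRay y := h2.clm (.fst ℝ Y _)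
  have h3 : AbsolutelyContinuousOnRay fun t => (P t).2.2 := h2.clm (.snd ℝ Y _)
  have haz : AbsolutelyContinuousOnRay z := h3.clm (.fst ℝ Z _)
  have h4 : AbsolutelyContinuousOnRay fun t => (P t).2.2.2 := h3.clm (.snd ℝ Z _)
  have haw : AbsolutelyContinuousOnRay w := h4.clm (.fst ℝ X _)
  have h5 : AbsolutelyContinuousOnRay fun t => (P t).2.2.2.2.2 :=
    (h4.clm (.snd ℝ X _)).clm (.snd ℝ X _)
  have hau : AbsolutelyContinuousOnRay u := h5.clm (.fst ℝ Y _)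
  have haθ : AbsolutelyContinuousOnRay θ := h5.clm (.snd ℝ Y _)
  -- the equations of motion and the decay of the energy
  have hmot : ∀ᵐ t ∂volume.restrict (Ioi (0 : ℝ)), 0 < t ∧ ∃ v, HasDerivAt x v t ∧
      HasDerivAt y (u t - O.R (θ t) + O.A (x t - v) - y t) t ∧
      HasDerivAt z (-(O.B (x t - v) + z t) + O.S (θ t)) t ∧
      HasDerivAt w (O.L (θ t)) t ∧
      HasDerivAt u (O.A (x t + v) - y t) t ∧
      HasDerivAt θ (O.R' (y t) - O.S' (z t) - O.L (w t) - O.L (θ t)) t ∧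
      ∃ e', HasDerivAt (fun s => O.energy G (P s)) e' t ∧
        ‖v‖ ^ 2 ≤ -e' ∧ 1 * ‖O.A (x t) - y t‖ ^ 2 ≤ -e' ∧ 1 * ‖O.B (x t) + z t‖ ^ 2 ≤ -e' ∧
        κ * ‖O.L (x t)‖ ^ 2 ≤ -e' ∧ κ * ‖O.L (θ t)‖ ^ 2 ≤ -e' := by
    filter_upwards [hdec, hpos] with t ⟨V, ⟨η, hη, e1, e2, e3, e4, e5, e6, e7⟩, hPV, e', he, hle⟩ ht
    refine ⟨ht, V.1, hPV.fst, HasDerivAt.congr_deriv (f' := V.2.1) hPV.snd.fst e2, ?_,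
      HasDerivAt.congr_deriv (f' := V.2.2.2.1) hPV.snd.snd.snd.fst e4,
      HasDerivAt.congr_deriv (f' := V.2.2.2.2.2.1) hPV.snd.snd.snd.snd.snd.fst e6,
      HasDerivAt.congr_deriv (f' := V.2.2.2.2.2.2) hPV.snd.snd.snd.snd.snd.snd e7, e', he, ?_⟩
    · rw [sub_zero] at e3
      exact HasDerivAt.congr_deriv (f' := V.2.2.1) hPV.snd.snd.fst e3
    · have g1 := sq_norm_le V.1
      have g2 := sq_norm_le (O.A (x t) - y t)
      have g3 := sq_norm_le (O.B (x t) + z t)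
      have g4 := hL (x t)
      have g5 := hL (θ t)
      have g6 : O.dissipation V.1 (P t) = form (O.B (x t) + z t) (O.B (x t) + z t)
        + form (O.A (x t) - y t) (O.A (x t) - y t)
        + form (x t) (O.L (x t)) + form (θ t) (O.L (θ t)) + form V.1 V.1 := rfl
      rw [g6] at hle
      have g7 := sq_nonneg ‖V.1‖
      have g8 := sq_nonneg ‖O.A (x t) - y t‖
      have g9 := sq_nonneg ‖O.B (x t) + z t‖
      have g10 := O.form_L_nonneg (x t)
      have g11 := O.form_L_nonneg (θ t)
      refine ⟨?_, ?_, ?_, ?_, ?_⟩ <;> linarith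
  clear hdec
  have hxs : IsSlowlyVarying x := by
    refine .of_sq_deriv_le hax hE hℓ ?_
    filter_upwards [hmot] with t ⟨ht, v, d1, d2, d3, d4, d5, d6, e', he, f1, f2, f3, f4, f5⟩
    exact ⟨v, e', d1, he, f1⟩
  -- Write `A x - y = 2 A x - (y + A x)`. The derivative of `y + A x` does not contain `x'`, so it
  -- is bounded, and `2 A x` is slowly varying.
  have hrow : Tendsto (fun t => O.A (x t) - y t) atTop (𝓝 0) := by
    obtain ⟨K, hK0, hK⟩ := exists_norm_comp_le hM
      (fun Q => Q.2.2.2.2.2.1 - O.R Q.2.2.2.2.2.2 + O.A Q.1 - Q.2.1)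
      (by fun_prop)
    have := tendsto_zero_of_sq_le_decay_of_slow_add (f := fun t => -(y t + O.A (x t)))
      (g := fun t => (2 : ℝ) • O.A (x t)) hE hℓ one_pos (hxs.clm ((2 : ℝ) • O.A))
      ((hay.add (hax.clm O.A)).clm (-ContinuousLinearMap.id ℝ Y)) hK0 ?_ ?_
    · refine this.congr fun t => ?_
      module
    · filter_upwards [hmot] with t ⟨ht, v, d1, d2, d3, d4, d5, d6, e', he, f1, f2, f3, f4, f5⟩
      refine ⟨_, (d2.add (O.A.hasFDerivAt.comp_hasDerivAt t d1)).neg, ?_⟩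
      rw [norm_neg]
      refine (congrArg norm ?_).le.trans (hK t ht.le)
      simp only [map_sub, hx, hy, hu, hθ]
      abel
    · filter_upwards [hmot] with t ⟨ht, v, d1, d2, d3, d4, d5, d6, e', he, f1, f2, f3, f4, f5⟩
      refine ⟨e', he, ?_⟩
      rwa [show (2 : ℝ) • O.A (x t) + -(y t + O.A (x t)) = O.A (x t) - y t by module]
  -- The same cancellation of the feedback, now with `B x + z = 2 B x + (z - B x)`.
  have hcol : Tendsto (fun t => O.B (x t) + z t) atTop (𝓝 0) := by
    obtain ⟨K, hK0, hK⟩ := exists_norm_comp_le hM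
      (fun Q => -(O.B Q.1 + Q.2.2.1) + O.S Q.2.2.2.2.2.2) (by fun_prop)
    have := tendsto_zero_of_sq_le_decay_of_slow_add (f := fun t => z t - O.B (x t))
      (g := fun t => (2 : ℝ) • O.B (x t)) hE hℓ one_pos (hxs.clm ((2 : ℝ) • O.B))
      (haz.sub (hax.clm O.B)) hK0 ?_ ?_
    · refine this.congr fun t => ?_
      module
    · filter_upwards [hmot] with t ⟨ht, v, d1, d2, d3, d4, d5, d6, e', he, f1, f2, f3, f4, f5⟩
      refine ⟨_, d3.sub (O.B.hasFDerivAt.comp_hasDerivAt t d1), ?_⟩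
      refine (congrArg norm ?_).le.trans (hK t ht.le)
      simp only [map_sub, hx, hz, hθ]
      abel
    · filter_upwards [hmot] with t ⟨ht, v, d1, d2, d3, d4, d5, d6, e', he, f1, f2, f3, f4, f5⟩
      refine ⟨e', he, ?_⟩
      rwa [show (2 : ℝ) • O.B (x t) + (z t - O.B (x t)) = O.B (x t) + z t by module]
  have hLx : Tendsto (fun t => O.L (x t)) atTop (𝓝 0) := by
    have := tendsto_zero_of_sq_le_decay_of_slow_add (f := fun t : ℝ => t • (0 : X))
      (g := fun t => O.L (x t)) hE hℓ hκ (hxs.clm O.L) (AbsolutelyContinuousOnRay.linear 0) le_rfl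
      ?_ ?_
    · simpa using this
    · refine Eventually.of_forall fun t => ⟨0, ?_, by simp⟩
      simpa using hasDerivAt_const t (0 : X)
    · filter_upwards [hmot] with t ⟨ht, v, d1, d2, d3, d4, d5, d6, e', he, f1, f2, f3, f4, f5⟩
      exact ⟨e', he, by simpa using f4⟩
  have hLθ : Tendsto (fun t => O.L (θ t)) atTop (𝓝 0) := by
    obtain ⟨K, hK0, hK⟩ := exists_norm_comp_le hM
      (fun Q => O.L (O.R' Q.2.1 - O.S' Q.2.2.1 - O.L Q.2.2.2.1
      - O.L Q.2.2.2.2.2.2)) (by fun_prop)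
    have := tendsto_zero_of_sq_le_decay_of_slow_add (f := fun t => O.L (θ t))
      (g := fun _ => 0) hE hℓ hκ (.of_tendsto_zero tendsto_const_nhds) (haθ.clm O.L) hK0 ?_ ?_
    · simpa using this
    · filter_upwards [hmot] with t ⟨ht, v, d1, d2, d3, d4, d5, d6, e', he, f1, f2, f3, f4, f5⟩
      exact ⟨_, O.L.hasFDerivAt.comp_hasDerivAt t d6, hK t ht.le⟩
    · filter_upwards [hmot] with t ⟨ht, v, d1, d2, d3, d4, d5, d6, e', he, f1, f2, f3, f4, f5⟩
      exact ⟨e', he, by simpa using f5⟩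
  have hys : IsSlowlyVarying y := by
    simpa using (hxs.clm O.A).sub (.of_tendsto_zero hrow)
  have hzs : IsSlowlyVarying z := by
    simpa using (IsSlowlyVarying.of_tendsto_zero hcol).sub (hxs.clm O.B)
  have hws : IsSlowlyVarying w := by
    refine .of_deriv_tendsto_zero haw (tendsto_zero_iff_norm_tendsto_zero.1 hLθ) ?_
    filter_upwards [hmot] with t ⟨ht, v, d1, d2, d3, d4, d5, d6, e', he, f1, f2, f3, f4, f5⟩
    exact ⟨_, d4, le_rfl⟩
  -- The derivative of the bounded `θ` is this slowly varying quantity up to `L θ → 0`.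
  have hbal : Tendsto (fun t => O.R' (y t) - O.S' (z t) - O.L (w t)) atTop (𝓝 0) := by
    obtain ⟨K, hK0, hK⟩ := exists_norm_comp_le hM
      (fun Q => Q.2.2.2.2.2.2) (by fun_prop)
    refine tendsto_zero_of_bounded_of_slow_drift haθ hK
      (((hys.clm O.R').sub (hzs.clm O.S')).sub (hws.clm O.L))
      (tendsto_zero_iff_norm_tendsto_zero.1 hLθ) ?_
    filter_upwards [hmot] with t ⟨ht, v, d1, d2, d3, d4, d5, d6, e', he, f1, f2, f3, f4, f5⟩
    refine ⟨_, d6, le_of_eq ?_⟩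
    rw [sub_sub_cancel_left, norm_neg]
  have hθs : IsSlowlyVarying θ := by
    have := hbal.sub hLθ
    rw [sub_zero] at this
    refine .of_deriv_tendsto_zero haθ (tendsto_zero_iff_norm_tendsto_zero.1 this) ?_
    filter_upwards [hmot] with t ⟨ht, v, d1, d2, d3, d4, d5, d6, e', he, f1, f2, f3, f4, f5⟩
    exact ⟨_, d6, le_rfl⟩
  have hus : IsSlowlyVarying u := by
    -- Subtracting `A x` removes `x'` from the equation for `u`; the remaining derivative is `A x -
    -- y → 0`.
    have : IsSlowlyVarying fun t => u t - O.A (x t) := by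
      refine .of_deriv_tendsto_zero (hau.sub (hax.clm O.A))
        (tendsto_zero_iff_norm_tendsto_zero.1 hrow) ?_
      filter_upwards [hmot] with t ⟨ht, v, d1, d2, d3, d4, d5, d6, e', he, f1, f2, f3, f4, f5⟩
      refine ⟨_, d5.sub (O.A.hasFDerivAt.comp_hasDerivAt t d1), le_of_eq ?_⟩
      congr 1
      rw [map_add]
      abel
    simpa using this.add (hxs.clm O.A)
  refine ⟨hrow, hcol, hLx, hLθ, hbal, ?_, ?_⟩
  -- The bounded curve `y + A x` drifts with velocity `u - R θ` up to `A x - y → 0`.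
  · obtain ⟨K, hK0, hK⟩ := exists_norm_comp_le hM
      (fun Q => Q.2.1 + O.A Q.1) (by fun_prop)
    refine tendsto_zero_of_bounded_of_slow_drift (hay.add (hax.clm O.A)) hK
      (hus.sub (hθs.clm O.R)) (tendsto_zero_iff_norm_tendsto_zero.1 hrow) ?_
    filter_upwards [hmot] with t ⟨ht, v, d1, d2, d3, d4, d5, d6, e', he, f1, f2, f3, f4, f5⟩
    refine ⟨_, d2.add (O.A.hasFDerivAt.comp_hasDerivAt t d1), le_of_eq ?_⟩
    congr 1
    rw [map_sub]
    abel
  -- The bounded curve `z - B x` drifts with velocity `S θ` up to `B x + z → 0`.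
  · obtain ⟨K, hK0, hK⟩ := exists_norm_comp_le hM
      (fun Q => Q.2.2.1 - O.B Q.1) (by fun_prop)
    refine tendsto_zero_of_bounded_of_slow_drift (haz.sub (hax.clm O.B)) hK
      (hθs.clm O.S) (tendsto_zero_iff_norm_tendsto_zero.1 hcol) ?_
    filter_upwards [hmot] with t ⟨ht, v, d1, d2, d3, d4, d5, d6, e', he, f1, f2, f3, f4, f5⟩
    refine ⟨_, d3.sub (O.B.hasFDerivAt.comp_hasDerivAt t d1), le_of_eq ?_⟩
    rw [← norm_neg]
    congr 1
    rw [map_sub]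
    abel

/-- Otherwise the energy would fall at rate at least `ε²` forever and become negative. -/
theorem exists_small_velocity (hG : ConvexOn ℝ univ G) (hG0 : ∀ x, 0 ≤ G x) (hG00 : G 0 = 0)
    (hP : IsSolution (O.field 0 G) P) {ε T : ℝ} (hε : 0 < ε) (hT : 0 ≤ T) :
    ∃ t, T ≤ t ∧ ∃ V ∈ O.field 0 G (P t), ‖V.1‖ ≤ ε := by
  by_contra! hcon
  have hE := absolutelyContinuousOnRay_energy (O := O) hG hP.1
  set e₀ := O.energy G (P T) with he₀
  have he₀0 : 0 ≤ e₀ := energy_nonneg hG0 _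
  have h := ((AbsolutelyContinuousOnRay.linear (-ε ^ 2)).sub hE).le_of_ae_deriv hT
    (b := T + (e₀ + 1) / ε ^ 2) (by linarith [show 0 ≤ (e₀ + 1) / ε ^ 2 by positivity]) ?_
  · have h1 := energy_nonneg (O := O) hG0 (P (T + (e₀ + 1) / ε ^ 2))
    have h2 : (e₀ + 1) / ε ^ 2 * ε ^ 2 = e₀ + 1 := by field_simp
    simp only [smul_eq_mul, ← he₀] at h
    linarith
  filter_upwards [ae_energy_decay hG hG0 hG00 hP] with t ⟨V, hV, _, e', he, hle⟩ ht
  refine ⟨_, ((hasDerivAt_id t).smul_const _).sub he, ?_⟩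
  have h1 := hcon t ht.1.le V hV
  have h2 := sq_norm_le V.1
  have h3 : form V.1 V.1 ≤ O.dissipation V.1 (P t) := by
    have g3 := form_self_nonneg (O.B (P t).1 + (P t).2.2.1)
    have g4 := form_self_nonneg (O.A (P t).1 - (P t).2.1)
    have g10 := O.form_L_nonneg (P t).1
    have g11 := O.form_L_nonneg (P t).2.2.2.2.2.2
    have : O.dissipation V.1 (P t) = form (O.B (P t).1 + (P t).2.2.1) (O.B (P t).1 + (P t).2.2.1)
      + form (O.A (P t).1 - (P t).2.1) (O.A (P t).1 - (P t).2.1) + form (P t).1 (O.L (P t).1)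
      + form (P t).2.2.2.2.2.2 (O.L (P t).2.2.2.2.2.2) + form V.1 V.1 := rfl
    linarith
  have h4 : ε ^ 2 ≤ ‖V.1‖ ^ 2 := by gcongr
  simp only [one_smul]
  linarith

theorem eq_zero_of_tendsto_comp {V W : Type*} [TopologicalSpace V] [NormedAddCommGroup W]
    {P : ℝ → V} {τ : ℕ → ℝ} {Q : V} (hQ : Tendsto (fun k => P (τ k)) atTop (𝓝 Q))
    (hτ : Tendsto τ atTop atTop) (ψ : V → W) (hψ : Continuous ψ)
    (h : Tendsto (fun t => ψ (P t)) atTop (𝓝 0)) : ψ Q = 0 :=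
  tendsto_nhds_unique ((hψ.tendsto Q).comp hQ) (h.comp hτ)

theorem exists_equilibrium_limit_point (hG : ConvexOn ℝ univ G) (hG0 : ∀ x, 0 ≤ G x)
    (hG00 : G 0 = 0) (hP : IsSolution (O.field 0 G) P) :
    ∃ Q, IsEquilibrium (O.field 0 G) Q ∧
      ∃ τ : ℕ → ℝ, Tendsto τ atTop atTop ∧ Tendsto (fun k => P (τ k)) atTop (𝓝 Q) := by
  obtain ⟨M, hM⟩ := exists_norm_le hG hG0 hG00 hP
  have hset := settles hG hG0 hG00 hP
  choose τ hτ V hV hV0 using fun k : ℕ => exists_small_velocity hG hG0 hG00 hP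
    (ε := 1 / (k + 1 : ℝ)) (T := k) (by positivity) (by positivity)
  choose η hη e1 _ using hV
  have hτ' : Tendsto τ atTop atTop := tendsto_atTop_mono hτ tendsto_natCast_atTop_atTop
  have hVlim : Tendsto (fun k => (V k).1) atTop (𝓝 0) :=
    squeeze_zero_norm hV0 tendsto_one_div_add_atTop_nhds_zero_nat
  obtain ⟨Q, -, φ, hφ, hQ⟩ := (isCompact_closedBall (0 : X × Y × Z × X × X × Y × X)
    M).tendsto_subseq
    (x := fun k => P (τ k)) fun k => by
      simpa using hM _ ((Nat.cast_nonneg k).trans (hτ k))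
  have hτφ : Tendsto (fun k => τ (φ k)) atTop atTop := hτ'.comp hφ.tendsto_atTop
  refine ⟨Q, ?_, fun k => τ (φ k), hτφ, hQ⟩
  have q1 := eq_zero_of_tendsto_comp hQ hτφ (fun Q => O.A Q.1 - Q.2.1) (by fun_prop) hset.row
  have q2 := eq_zero_of_tendsto_comp hQ hτφ (fun Q => O.B Q.1 + Q.2.2.1) (by fun_prop) hset.col
  have q3 := eq_zero_of_tendsto_comp hQ hτφ (fun Q => O.L Q.1) (by fun_prop) hset.consensus
  have q4 := eq_zero_of_tendsto_comp hQ hτφ (fun Q => O.L Q.2.2.2.2.2.2) (by fun_prop)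
    hset.dual_consensus
  have q5 := eq_zero_of_tendsto_comp hQ hτφ (fun Q => O.R' Q.2.1 - O.S' Q.2.2.1 - O.L Q.2.2.2.1) (by fun_prop)
    hset.balance
  have q6 := eq_zero_of_tendsto_comp hQ hτφ (fun Q => Q.2.2.2.2.2.1 - O.R Q.2.2.2.2.2.2) (by fun_prop)
    hset.dual_row
  have q7 := eq_zero_of_tendsto_comp hQ hτφ (fun Q => O.S Q.2.2.2.2.2.2) (by fun_prop) hset.dual_col
  -- The first equation expresses the subgradient as `N` of the state minus the velocity of `x`.
  -- Along the chosen times that velocity vanishes, so the subgradients converge.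
  set N : X × Y × Z × X × X × Y × X → X := fun Q => -O.B' (O.B Q.1 + Q.2.2.1)
    - O.A' Q.2.2.2.2.2.1 - O.L Q.2.2.2.2.1 - O.A' (O.A Q.1 - Q.2.1) - O.L Q.1 with hN
  have hNc : Continuous N := by fun_prop
  have hηlim : Tendsto (fun k => η (φ k)) atTop (𝓝 (N Q)) := by
    have h1 := ((hNc.tendsto Q).comp hQ).sub (hVlim.comp hφ.tendsto_atTop)
    rw [sub_zero] at h1
    refine h1.congr fun k => ?_
    simp only [Function.comp, hN]
    rw [e1 (φ k), sub_zero]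
    abel
  have hxlim : Tendsto (fun k => (P (τ (φ k))).1) atTop (𝓝 Q.1) :=
    (continuous_fst.tendsto Q).comp hQ
  have hmem := mem_formSubdiff_of_tendsto hG.locallyLipschitz.continuous hxlim hηlim
    fun k => hη (φ k)
  refine ⟨N Q, hmem, ?_, ?_, ?_, ?_, ?_, ?_, ?_⟩
  · simp only [hN, Prod.fst_zero, sub_zero]
    abel
  · simp only [Prod.fst_zero, Prod.snd_zero, sub_zero]
    rw [q6, zero_add, q1]
  · simp only [Prod.fst_zero, Prod.snd_zero, sub_zero]
    rw [q2, q7]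
    simp
  · exact q4.symm
  · simp only [Prod.fst_zero, Prod.snd_zero, map_zero, add_zero]
    exact q3.symm
  · simp only [Prod.fst_zero, Prod.snd_zero, add_zero]
    exact q1.symm
  · simp only [Prod.snd_zero]
    rw [q5, q4, sub_zero]

end Homogeneous

end SaddleOperators

/-! ### Recentring at an equilibrium, stability and convergence. -/

namespace SaddleOperators

variable {X Y Z : Type*} [NormedAddCommGroup X] [NormedSpace ℝ X] [EnergyForm X]
    [NormedAddCommGroup Y] [NormedSpace ℝ Y] [EnergyForm Y] [NormedAddCommGroup Z]
    [NormedSpace ℝ Z] [EnergyForm Z] (O : SaddleOperators X Y Z)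

/-- Recentring the flow at an equilibrium. -/
theorem exists_field_recentre {c : Z} {G : X → ℝ} {Q : X × Y × Z × X × X × Y × X}
    (hQ : IsEquilibrium (O.field c G) Q) :
    ∃ η₀ ∈ formSubdiff G Q.1, ∀ p V, V ∈ O.field c G (p + Q) ↔
      V ∈ O.field 0 (recentre G Q.1 η₀) p := by
  obtain ⟨x₀, y₀, z₀, w₀, l₀, u₀, θ₀⟩ := Q
  obtain ⟨η₀, hη₀, e1, e2, e3, e4, e5, e6, e7⟩ := hQ
  simp only [Prod.fst_zero, Prod.snd_zero] at e1 e2 e3 e4 e5 e6 e7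
  refine ⟨η₀, hη₀, ?_⟩
  rintro ⟨x, y, z, w, l, u, θ⟩ ⟨x', y', z', w', l', u', θ'⟩
  have i1 (η : X) : -O.B' (O.B (x + x₀) - c + (z + z₀)) - (η + η₀) - O.A' (u + u₀) - O.L (l + l₀)
      - O.A' (O.A (x + x₀) - (y + y₀)) - O.L (x + x₀)
      = -O.B' (O.B x - 0 + z) - η - O.A' u - O.L l - O.A' (O.A x - y) - O.L x := by
    -- The added `0` is replaced by the first equilibrium equation; what remains is linearity. The
    -- later identities work alike.
    rw [← add_zero (-O.B' (O.B x - 0 + z) - η - O.A' u - O.L l - O.A' (O.A x - y) - O.L x), e1]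
    simp only [map_add, map_sub, map_zero]
    abel
  have i2 : u + u₀ - O.R (θ + θ₀) + O.A (x + x₀ - x') - (y + y₀)
      = u - O.R θ + O.A (x - x') - y := by
    rw [← add_zero (u - O.R θ + O.A (x - x') - y), e2]
    simp only [map_add, map_sub, sub_zero]
    abel
  have i3 : -(O.B (x + x₀ - x') - c + (z + z₀)) + O.S (θ + θ₀)
      = -(O.B (x - x') - 0 + z) + O.S θ := by
    refine Eq.trans ?_ ((congrArg (_ + ·) e3.symm).trans (add_zero _))
    simp only [map_add, map_sub, sub_zero]
    abel
  have i4 : O.L (θ + θ₀) = O.L θ := by rw [map_add, ← e4, add_zero]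
  have i5 : O.L (x + x₀) = O.L x := by
    rw [map_zero, add_zero] at e5
    rw [map_add, ← e5, add_zero]
  have i6 : O.A (x + x₀ + x') - (y + y₀) = O.A (x + x') - y := by
    rw [← add_zero (O.A (x + x') - y), e6]
    simp only [map_add, add_zero]
    abel
  have i7 : O.R' (y + y₀) - O.S' (z + z₀) - O.L (w + w₀) = O.R' y - O.S' z - O.L w := by
    rw [← e4, sub_zero] at e7
    refine Eq.trans ?_ ((congrArg (_ + ·) e7.symm).trans (add_zero _))
    simp only [map_add]
    abel
  simp only [field, mem_ofPred_eq, i2, i3, i4, i5, i6, i7]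
  simp only [i5] at i1
  constructor
  · rintro ⟨η, hη, h1, h⟩
    refine ⟨η - η₀, mem_formSubdiff_recentre.2 (by simpa using hη), ?_, h⟩
    rw [← i1, sub_add_cancel, h1]
  · rintro ⟨η, hη, h1, h⟩
    exact ⟨η + η₀, mem_formSubdiff_recentre.1 hη, by rw [i1, h1], h⟩

variable [FiniteDimensional ℝ X] [FiniteDimensional ℝ Y] [FiniteDimensional ℝ Z]
variable {O} {c : Z} {G : X → ℝ}

theorem isSolution_sub {η₀ : X} {Q : X × Y × Z × X × X × Y × X}
    (h : ∀ p V, V ∈ O.field c G (p + Q) ↔ V ∈ O.field 0 (recentre G Q.1 η₀) p)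
    {P : ℝ → X × Y × Z × X × X × Y × X} (hP : IsSolution (O.field c G) P) :
    IsSolution (O.field 0 (recentre G Q.1 η₀)) fun t => P t - Q := by
  refine ⟨fun T hT => (hP.1 T hT).fun_sub ?_, ?_⟩
  · exact ((LipschitzWith.const Q).lipschitzOnWith (s := uIcc 0 T)).absolutelyContinuousOnInterval
  · filter_upwards [hP.2] with t ⟨V, hV, hPV⟩
    exact ⟨V, (h _ _).1 (by simpa using hV), hPV.sub_const Q⟩

/-- The recentred energy is continuous, vanishes at the equilibrium, never increases and dominates
half the squared distance. -/
theorem isLyapunovStable (hG : ConvexOn ℝ univ G) {Q : X × Y × Z × X × X × Y × X}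
    (hQ : IsEquilibrium (O.field c G) Q) : IsLyapunovStable (O.field c G) Q := by
  refine ⟨hQ, fun ε hε => ?_⟩
  obtain ⟨η₀, hη₀, h⟩ := O.exists_field_recentre hQ
  have hH := convexOn_recentre hG Q.1 η₀
  have hH0 := recentre_nonneg hη₀
  have hH00 := recentre_zero G Q.1 η₀
  have hc := (continuous_energy (O := O) hH).tendsto 0
  rw [energy_zero hH00] at hc
  obtain ⟨δ, hδ, hδ'⟩ := Metric.eventually_nhds_iff.1
    (hc.eventually (gt_mem_nhds (show 0 < ε ^ 2 / 2 by positivity)))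
  refine ⟨δ, hδ, fun P hP hP0 t ht => ?_⟩
  have hsol := isSolution_sub h hP
  have h1 := energy_antitone hH hH0 hH00 hsol le_rfl ht
  have h2 := hδ' (show dist (P 0 - Q) 0 < δ by simpa using hP0)
  have h3 := sq_norm_le_energy (O := O) hH0 (P t - Q)
  exact lt_of_pow_lt_pow_left₀ 2 hε.le (by linarith)

theorem isBounded_of_isSolution (hG : ConvexOn ℝ univ G)
    (hex : ∃ Q, IsEquilibrium (O.field c G) Q)
    {P : ℝ → X × Y × Z × X × X × Y × X} (hP : IsSolution (O.field c G) P) :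
    Bornology.IsBounded (P '' Ici 0) := by
  obtain ⟨Q, hQ⟩ := hex
  obtain ⟨η₀, hη₀, h⟩ := O.exists_field_recentre hQ
  obtain ⟨M, hM⟩ := exists_norm_le (convexOn_recentre hG Q.1 η₀) (recentre_nonneg hη₀)
    (recentre_zero G Q.1 η₀) (isSolution_sub h hP)
  rw [isBounded_iff_forall_norm_le]
  refine ⟨M + ‖Q‖, ?_⟩
  rintro _ ⟨t, ht, rfl⟩
  calc ‖P t‖ = ‖P t - Q + Q‖ := by rw [sub_add_cancel]
    _ ≤ M + ‖Q‖ := (norm_add_le _ _).trans (by gcongr; exact hM t ht)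

theorem exists_tendsto_equilibrium (hG : ConvexOn ℝ univ G)
    (hex : ∃ Q, IsEquilibrium (O.field c G) Q)
    {P : ℝ → X × Y × Z × X × X × Y × X} (hP : IsSolution (O.field c G) P) :
    ∃ Q, IsEquilibrium (O.field c G) Q ∧ Tendsto P atTop (𝓝 Q) := by
  obtain ⟨Q, hQ, τ, hτ, hlim⟩ : ∃ Q, IsEquilibrium (O.field c G) Q ∧
      ∃ τ : ℕ → ℝ, Tendsto τ atTop atTop ∧ Tendsto (fun k => P (τ k)) atTop (𝓝 Q) := by
    obtain ⟨Q, hQ⟩ := hex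
    obtain ⟨η₀, hη₀, h⟩ := O.exists_field_recentre hQ
    obtain ⟨Q', hQ', τ, hτ, hlim⟩ := exists_equilibrium_limit_point (convexOn_recentre hG Q.1 η₀)
      (recentre_nonneg hη₀) (recentre_zero G Q.1 η₀) (isSolution_sub h hP)
    exact ⟨Q' + Q, (h _ _).2 hQ', τ, hτ, by simpa using hlim.add_const Q⟩
  refine ⟨Q, hQ, ?_⟩
  -- The second recentring is at the limit point itself, so that the energy tends to `0` along `τ`
  -- and its limit must be `0`.
  obtain ⟨η₀, hη₀, h⟩ := O.exists_field_recentre hQ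
  have hH := convexOn_recentre hG Q.1 η₀
  have hH0 := recentre_nonneg hη₀
  have hH00 := recentre_zero G Q.1 η₀
  have hsol := isSolution_sub h hP
  obtain ⟨ℓ, hℓ⟩ := exists_tendsto_energy hH hH0 hH00 hsol
  have hsub : Tendsto (fun k => P (τ k) - Q) atTop (𝓝 0) := by
    simpa using hlim.sub_const Q
  have h0 : Tendsto (fun k => O.energy (recentre G Q.1 η₀) (P (τ k) - Q)) atTop (𝓝 0) := by
    have := ((continuous_energy (O := O) hH).tendsto 0).comp hsub
    rwa [energy_zero hH00] at this
  have hℓ0 : ℓ = 0 := tendsto_nhds_unique (hℓ.comp hτ) h0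
  rw [hℓ0] at hℓ
  rw [← tendsto_sub_nhds_zero_iff, tendsto_zero_iff_norm_tendsto_zero]
  have h1 : Tendsto (fun t => √(2 * O.energy (recentre G Q.1 η₀) (P t - Q))) atTop (𝓝 0) := by
    have := (hℓ.const_mul 2).sqrt
    simpa using this
  exact squeeze_zero (fun _ => norm_nonneg _)
    (fun t => Real.le_sqrt_of_sq_le (sq_norm_le_energy (O := O) hH0 _)) h1

end SaddleOperators

/-! ### The Frobenius inner product as an energy form. -/

section FrobeniusInner

variable {κ ι ν : Type*} [Fintype κ] [Fintype ι] [Fintype ν]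

theorem frobInner_comm (M N : Matrix κ ι ℝ) : frobInner M N = frobInner N M := by
  simp only [frobInner, mul_comm]

theorem frobInner_add_left (M M' N : Matrix κ ι ℝ) :
    frobInner (M + M') N = frobInner M N + frobInner M' N := by
  simp only [frobInner, Matrix.add_apply, add_mul, Finset.sum_add_distrib]

theorem frobInner_smul_left (c : ℝ) (M N : Matrix κ ι ℝ) :
    frobInner (c • M) N = c * frobInner M N := by
  simp only [frobInner, Matrix.smul_apply, smul_eq_mul, Finset.mul_sum, mul_assoc]

theorem frobInner_add_right (M N N' : Matrix κ ι ℝ) :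
    frobInner M (N + N') = frobInner M N + frobInner M N' := by
  simp only [frobInner_comm M, frobInner_add_left]

theorem frobInner_smul_right (c : ℝ) (M N : Matrix κ ι ℝ) :
    frobInner M (c • N) = c * frobInner M N := by
  simp only [frobInner_comm M, frobInner_smul_left]

theorem frobInner_self_eq_sq_norm (M : Matrix κ ι ℝ) : frobInner M M = ‖M‖ ^ 2 := by
  have h : 0 ≤ ∑ i, ∑ j, ‖M i j‖ ^ 2 := by positivity
  rw [Matrix.frobenius_norm_def]
  simp only [Real.rpow_two]
  rw [← Real.sqrt_eq_rpow, Real.sq_sqrt h]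
  simp only [frobInner, Real.norm_eq_abs, sq, abs_mul_abs_self]

theorem frobInner_mul_left (M : Matrix ν κ ℝ) (N : Matrix κ ι ℝ) (K : Matrix ν ι ℝ) :
    frobInner (M * N) K = frobInner N (M.transpose * K) := by
  simp only [frobInner, Matrix.mul_apply, Matrix.transpose_apply, Finset.sum_mul, Finset.mul_sum]
  have h1 : ∀ p, ∑ q, ∑ i, M p i * N i q * K p q = ∑ i, ∑ q, M p i * N i q * K p q :=
    fun p => Finset.sum_comm
  have h2 : ∀ p, ∑ q, ∑ i, N p q * (M i p * K i q) = ∑ i, ∑ q, N p q * (M i p * K i q) :=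
    fun p => Finset.sum_comm
  simp only [h1, h2]
  rw [Finset.sum_comm]
  refine Finset.sum_congr rfl fun _ _ => Finset.sum_congr rfl fun _ _ =>
    Finset.sum_congr rfl fun _ _ => by ring

theorem frobInner_transpose (M N : Matrix κ ι ℝ) :
    frobInner M.transpose N.transpose = frobInner M N := by
  simp only [frobInner, Matrix.transpose_apply]
  exact Finset.sum_comm

theorem frobInner_mul_right (N : Matrix ι κ ℝ) (M : Matrix κ ν ℝ) (K : Matrix ι ν ℝ) :
    frobInner (N * M) K = frobInner N (K * M.transpose) := by
  rw [← frobInner_transpose, Matrix.transpose_mul, frobInner_mul_left, ← frobInner_transpose N,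
    Matrix.transpose_mul]

noncomputable instance : EnergyForm (Matrix κ ι ℝ) where
  form := (LinearMap.mk₂ ℝ frobInner frobInner_add_left frobInner_smul_left frobInner_add_right
    frobInner_smul_right).toContinuousBilinearMap
  form_comm := frobInner_comm
  sq_norm_le M := (frobInner_self_eq_sq_norm M).ge

theorem form_matrix (M N : Matrix κ ι ℝ) : form M N = frobInner M N := rfl

theorem frobInner_sub_left (M M' N : Matrix κ ι ℝ) :
    frobInner (M - M') N = frobInner M N - frobInner M' N := by
  simp only [← form_matrix, map_sub, sub_apply]

theorem frobInner_sub_right (M N N' : Matrix κ ι ℝ) :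
    frobInner M (N - N') = frobInner M N - frobInner M N' := by
  simp only [← form_matrix, map_sub]

theorem frobInner_sum_left {J : Type*} (s : Finset J) (f : J → Matrix κ ι ℝ) (N : Matrix κ ι ℝ) :
    frobInner (∑ j ∈ s, f j) N = ∑ j ∈ s, frobInner (f j) N := by
  simp only [← form_matrix, map_sum, sum_apply]

theorem frobInner_self_nonneg (M : Matrix κ ι ℝ) : 0 ≤ frobInner M M := form_self_nonneg M

theorem frobInner_self_eq_zero {M : Matrix κ ι ℝ} (h : frobInner M M = 0) : M = 0 := by
  rw [frobInner_self_eq_sq_norm] at h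
  simpa using h

end FrobeniusInner

/-! ### Energy forms on finite families. -/

section PiForm

variable {J : Type*} [Fintype J] {V : J → Type*} [∀ j, NormedAddCommGroup (V j)]
  [∀ j, NormedSpace ℝ (V j)] [∀ j, EnergyForm (V j)]

noncomputable instance : EnergyForm (∀ j, V j) where
  form := ∑ j, (form (X := V j)).bilinearComp (ContinuousLinearMap.proj j)
    (ContinuousLinearMap.proj j)
  form_comm x y := by simp [form_comm]
  sq_norm_le x := by
    have h : ∀ j, 0 ≤ form (x j) (x j) := fun j => form_self_nonneg _
    have h0 : 0 ≤ ∑ j, form (x j) (x j) := Finset.sum_nonneg fun j _ => h j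
    have key : ‖x‖ ≤ √(∑ j, form (x j) (x j)) := by
      refine (pi_norm_le_iff_of_nonneg (Real.sqrt_nonneg _)).2 fun j => Real.le_sqrt_of_sq_le ?_
      exact (sq_norm_le _).trans
        (Finset.single_le_sum (f := fun j => form (x j) (x j)) (fun j _ => h j) (Finset.mem_univ j))
    have := pow_le_pow_left₀ (norm_nonneg _) key 2
    rw [Real.sq_sqrt h0] at this
    simpa using this

theorem form_pi (x y : ∀ j, V j) : form x y = ∑ j, form (x j) (y j) := by
  change (∑ j, (form (X := V j)).bilinearComp (ContinuousLinearMap.proj j)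
    (ContinuousLinearMap.proj j)) x y = _
  simp

end PiForm

/-! ### The graph Laplacian. -/

section Laplacian

variable {n : ℕ} {κ ι : Type*} [Fintype κ] [Fintype ι] {a : Matrix (Fin n) (Fin n) ℝ}

/-- Symmetry of the weights allows averaging the sum with its copy in which `i` and `j` are
exchanged. Self-adjointness and nonnegativity of the Laplacian can be read off. -/
theorem sum_frobInner_disagreement (ha : IsUndirectedWeight a) (U W : Fin n → Matrix κ ι ℝ) :
    ∑ i, frobInner (disagreement a U i) (W i)
      = 1 / 2 * ∑ i, ∑ j, a i j * frobInner (U i - U j) (W i - W j) := by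
  have h1 : ∑ i, frobInner (disagreement a U i) (W i)
      = ∑ i, ∑ j, a i j * frobInner (U i - U j) (W i) := by
    simp only [disagreement, frobInner_sum_left, frobInner_smul_left]
  have h2 : ∑ i, ∑ j, a i j * frobInner (U i - U j) (W i)
      = -∑ i, ∑ j, a i j * frobInner (U i - U j) (W j) := by
    rw [Finset.sum_comm, ← Finset.sum_neg_distrib]
    refine Finset.sum_congr rfl fun i _ => ?_
    rw [← Finset.sum_neg_distrib]
    refine Finset.sum_congr rfl fun j _ => ?_
    rw [ha.symm j i, frobInner_sub_left, frobInner_sub_left]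
    ring
  simp only [frobInner_sub_right _ (W _) (W _), mul_sub, Finset.sum_sub_distrib]
  linarith

theorem sum_frobInner_disagreement_comm (ha : IsUndirectedWeight a) (U W : Fin n → Matrix κ ι ℝ) :
    ∑ i, frobInner (disagreement a U i) (W i) = ∑ i, frobInner (U i) (disagreement a W i) := by
  simp only [frobInner_comm (U _)]
  rw [sum_frobInner_disagreement ha, sum_frobInner_disagreement ha]
  simp only [frobInner_comm (U _ - U _)]

theorem sum_disagreement (ha : IsUndirectedWeight a) (U : Fin n → Matrix κ ι ℝ) :
    ∑ i, disagreement a U i = 0 := by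
  have h : ∑ i, disagreement a U i = -∑ i, disagreement a U i := by
    conv_lhs => simp only [disagreement]
    rw [Finset.sum_comm, ← Finset.sum_neg_distrib]
    refine Finset.sum_congr rfl fun i _ => ?_
    rw [disagreement, ← Finset.sum_neg_distrib]
    refine Finset.sum_congr rfl fun j _ => ?_
    rw [ha.symm j i, ← smul_neg, neg_sub]
  have h2 : (2 : ℝ) • ∑ i, disagreement a U i = 0 := by
    rw [two_smul]
    nth_rewrite 1 [h]
    exact neg_add_cancel _
  simpa using h2

/-- The Dirichlet energy vanishes, so adjacent agents agree, and equality propagates along walks. -/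
theorem eq_of_disagreement_eq_zero (ha : IsUndirectedWeight a) (hconn : (weightGraph a).Connected)
    {U : Fin n → Matrix κ ι ℝ} (h : ∀ i, disagreement a U i = 0) (i j : Fin n) : U i = U j := by
  have h1 := sum_frobInner_disagreement ha U U
  have h0 : ∑ i, frobInner (disagreement a U i) (U i) = 0 := by
    refine Finset.sum_eq_zero fun i _ => ?_
    rw [h i, ← form_matrix, map_zero, zero_apply]
  have hnn : ∀ i j, 0 ≤ a i j * frobInner (U i - U j) (U i - U j) := fun i j =>
    mul_nonneg (ha.nonneg i j) (frobInner_self_nonneg _)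
  have h2 : ∑ i, ∑ j, a i j * frobInner (U i - U j) (U i - U j) = 0 := by linarith
  rw [Finset.sum_eq_zero_iff_of_nonneg fun i _ => Finset.sum_nonneg fun j _ => hnn i j] at h2
  have hadj : ∀ i j, (weightGraph a).Adj i j → U i = U j := by
    intro i j hij
    have h3 := h2 i (Finset.mem_univ i)
    rw [Finset.sum_eq_zero_iff_of_nonneg fun j _ => hnn i j] at h3
    have h4 := h3 j (Finset.mem_univ j)
    have hpos : 0 < a i j := by
      rcases (SimpleGraph.fromRel_adj _ _ _).1 hij with ⟨_, h | h⟩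
      · exact h
      · rw [ha.symm]; exact h
    rcases mul_eq_zero.1 h4 with h5 | h5
    · exact absurd h5 hpos.ne'
    · exact sub_eq_zero.1 (frobInner_self_eq_zero h5)
  obtain ⟨p⟩ := hconn.preconnected i j
  induction p with
  | nil => rfl
  | cons hij _ ih => exact (hadj _ _ hij).trans ih

theorem disagreement_const (M : Matrix κ ι ℝ) (i : Fin n) : disagreement a (fun _ => M) i = 0 := by
  simp [disagreement]

/-- `disagreement` as a linear map. -/
noncomputable def disagreementₗ (a : Matrix (Fin n) (Fin n) ℝ) :
    (Fin n → Matrix κ ι ℝ) →ₗ[ℝ] (Fin n → Matrix κ ι ℝ) where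
  toFun U := disagreement a U
  map_add' U W := by
    ext1 i
    simp only [disagreement, Pi.add_apply, add_sub_add_comm, smul_add, Finset.sum_add_distrib]
  map_smul' c U := by
    ext1 i
    simp only [disagreement, Pi.smul_apply, ← smul_sub, smul_comm c, Finset.smul_sum,
      RingHom.id_apply]

/-- On a connected graph, the range of the Laplacian consists of the families with zero sum. -/
theorem exists_disagreement_eq (ha : IsUndirectedWeight a) (hconn : (weightGraph a).Connected)
    {R : Fin n → Matrix κ ι ℝ} (hR : ∑ i, R i = 0) :
    ∃ U : Fin n → Matrix κ ι ℝ, ∀ i, disagreement a U i = R i := by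
  obtain ⟨i₀⟩ := hconn.nonempty
  have hn : (n : ℝ) ≠ 0 := by
    have : 0 < n := i₀.pos
    positivity
  -- Adding the total sum to every component makes the Laplacian injective, hence surjective in
  -- finite dimension. A zero-sum right-hand side forces a zero-sum preimage, on which `T` is the
  -- Laplacian.
  let T : (Fin n → Matrix κ ι ℝ) →ₗ[ℝ] (Fin n → Matrix κ ι ℝ) :=
    disagreementₗ a + LinearMap.pi fun _ => ∑ j, LinearMap.proj j
  have hT : ∀ U i, T U i = disagreement a U i + ∑ j, U j := by
    intro U i
    simp [T, disagreementₗ]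
  have hsum : ∀ U, ∑ i, T U i = (n : ℝ) • ∑ j, U j := by
    intro U
    simp only [hT, Finset.sum_add_distrib, sum_disagreement ha, zero_add, Finset.sum_const,
      Finset.card_univ, Fintype.card_fin, Nat.cast_smul_eq_nsmul]
  have hinj : Function.Injective T := by
    rw [injective_iff_map_eq_zero]
    intro U hU
    have h1 : ∑ j, U j = 0 := by
      have := hsum U
      rw [hU] at this
      simpa [hn] using this.symm
    have h2 : ∀ i, disagreement a U i = 0 := by
      intro i
      have := hT U i
      rw [hU, h1] at this
      simpa using this.symm
    ext1 i
    have h3 : ∑ j, U j = (n : ℝ) • U i := by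
      rw [Finset.sum_congr rfl fun j _ => eq_of_disagreement_eq_zero ha hconn h2 j i]
      simp [Nat.cast_smul_eq_nsmul]
    rw [h1] at h3
    simpa [hn] using h3.symm
  obtain ⟨U, hU⟩ := (LinearMap.injective_iff_surjective.1 hinj) R
  refine ⟨U, fun i => ?_⟩
  have h1 := hsum U
  rw [hU, hR] at h1
  have h2 : ∑ j, U j = 0 := by simpa [hn] using h1.symm
  rw [← hU, hT, h2, add_zero]

end Laplacian

/-! ### Cutting matrices into blocks and reassembling them. -/

section BlockAlgebra

variable {n : ℕ} {κ : Type*} {s : Fin n → ℕ}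

theorem rowPad_apply_self (i : Fin n) (M : Matrix (Fin (s i)) κ ℝ) (k : Fin (s i)) (q : κ) :
    rowPad i M ⟨i, k⟩ q = M k q := by simp [rowPad]

theorem rowPad_apply_of_ne {i j : Fin n} (h : j ≠ i) (M : Matrix (Fin (s i)) κ ℝ) (k : Fin (s j))
    (q : κ) : rowPad i M ⟨j, k⟩ q = 0 := by simp [rowPad, h]

theorem colPad_apply_self (i : Fin n) (M : Matrix κ (Fin (s i)) ℝ) (p : κ) (k : Fin (s i)) :
    colPad i M p ⟨i, k⟩ = M p k := by simp [colPad]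

theorem colPad_apply_of_ne {i j : Fin n} (h : j ≠ i) (M : Matrix κ (Fin (s i)) ℝ) (p : κ)
    (k : Fin (s j)) : colPad i M p ⟨j, k⟩ = 0 := by simp [colPad, h]

theorem transpose_colPad (i : Fin n) (M : Matrix κ (Fin (s i)) ℝ) :
    (colPad i M).transpose = rowPad i M.transpose := rfl

theorem transpose_rowPad (i : Fin n) (M : Matrix (Fin (s i)) κ ℝ) :
    (rowPad i M).transpose = colPad i M.transpose := rfl

theorem colPad_one_mul (i : Fin n) (M : Matrix (Idx s) κ ℝ) :
    colPad i (1 : Matrix (Fin (s i)) (Fin (s i)) ℝ) * M = rowBlock i M := by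
  ext k q
  rw [Matrix.mul_apply, Fintype.sum_sigma, Finset.sum_eq_single i]
  · simp [colPad_apply_self, Matrix.one_apply, rowBlock]
  · intro j _ hj
    simp [colPad_apply_of_ne hj]
  · simp

theorem mul_rowPad_one (i : Fin n) (M : Matrix κ (Idx s) ℝ) :
    M * rowPad i (1 : Matrix (Fin (s i)) (Fin (s i)) ℝ) = colBlock i M := by
  ext p k
  rw [Matrix.mul_apply, Fintype.sum_sigma, Finset.sum_eq_single i]
  · simp [rowPad_apply_self, Matrix.one_apply, colBlock]
  · intro j _ hj
    simp [rowPad_apply_of_ne hj]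
  · simp

theorem rowPad_one_mul (i : Fin n) (M : Matrix (Fin (s i)) κ ℝ) :
    rowPad i (1 : Matrix (Fin (s i)) (Fin (s i)) ℝ) * M = rowPad i M := by
  ext ⟨j, k⟩ q
  rw [Matrix.mul_apply]
  by_cases h : j = i
  · subst h
    simp [rowPad_apply_self, Matrix.one_apply]
  · simp [rowPad_apply_of_ne h]

theorem mul_colPad_one (i : Fin n) (M : Matrix κ (Fin (s i)) ℝ) :
    M * colPad i (1 : Matrix (Fin (s i)) (Fin (s i)) ℝ) = colPad i M := by
  ext p ⟨j, k⟩
  rw [Matrix.mul_apply]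
  by_cases h : j = i
  · subst h
    simp [colPad_apply_self, Matrix.one_apply]
  · simp [colPad_apply_of_ne h]

theorem colBlock_sum_colPad (Z : (i : Fin n) → Matrix κ (Fin (s i)) ℝ) (i : Fin n) :
    colBlock i (∑ j, colPad j (Z j)) = Z i := by
  ext p k
  rw [colBlock, Matrix.sum_apply, Finset.sum_eq_single i]
  · exact colPad_apply_self i _ _ _
  · intro j _ hj
    exact colPad_apply_of_ne hj.symm _ _ _
  · simp

theorem sum_rowPad_rowBlock (M : Matrix (Idx s) κ ℝ) : ∑ j, rowPad j (rowBlock j M) = M := by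
  ext ⟨i, k⟩ q
  rw [Matrix.sum_apply, Finset.sum_eq_single i]
  · exact rowPad_apply_self i _ _ _
  · intro j _ hj
    exact rowPad_apply_of_ne hj.symm _ _ _
  · simp

theorem eq_of_colBlock_eq {M N : Matrix κ (Idx s) ℝ} (h : ∀ i, colBlock i M = colBlock i N) :
    M = N := by
  ext p ⟨i, k⟩
  exact congrFun (congrFun (h i) p) k

theorem sum_colPad_colBlock (M : Matrix κ (Idx s) ℝ) : ∑ j, colPad j (colBlock j M) = M :=
  eq_of_colBlock_eq fun i => colBlock_sum_colPad _ i

theorem sum_transpose_rowBlock_mul {ν : Type*} (M : Matrix (Idx s) κ ℝ) (N : Matrix (Idx s) ν ℝ) :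
    ∑ i, (rowBlock i M).transpose * rowBlock i N = M.transpose * N := by
  ext p q
  simp only [Matrix.sum_apply, Matrix.mul_apply, Matrix.transpose_apply, rowBlock,
    Fintype.sum_sigma]

theorem sum_colBlock_mul_transpose {ν : Type*} (M : Matrix κ (Idx s) ℝ) (N : Matrix ν (Idx s) ℝ) :
    ∑ i, colBlock i M * (colBlock i N).transpose = M * N.transpose := by
  ext p q
  simp only [Matrix.sum_apply, Matrix.mul_apply, Matrix.transpose_apply, colBlock,
    Fintype.sum_sigma]

theorem rowBlock_mul {ν : Type*} [Fintype ν] (i : Fin n) (M : Matrix (Idx s) ν ℝ)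
    (N : Matrix ν κ ℝ) : rowBlock i M * N = rowBlock i (M * N) := rfl

theorem mul_colBlock {ν : Type*} [Fintype ν] (i : Fin n) (M : Matrix κ ν ℝ)
    (N : Matrix ν (Idx s) ℝ) : M * colBlock i N = colBlock i (M * N) := rfl

end BlockAlgebra

/-! ### The separable penalty. -/

section Subdifferential

variable {κ ι : Type*} [Fintype κ] [Fintype ι] {n : ℕ} {g : Matrix κ ι ℝ → ℝ} {α : ℝ}

theorem mem_formSubdiff_sum (hα : 0 < α) {x η : Fin n → Matrix κ ι ℝ} :
    η ∈ formSubdiff (fun x : Fin n → Matrix κ ι ℝ => α * ∑ i, g (x i)) x ↔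
      ∀ i, α⁻¹ • η i ∈ subdiff g (x i) := by
  constructor
  · intro h i X'
    -- Varying a single component isolates the inequality of agent `i`.
    have h1 := h (Function.update x i X')
    rw [form_pi, Finset.sum_eq_single i] at h1
    · have h2 : ∑ j, g (Function.update x i X' j) - ∑ j, g (x j) = g X' - g (x i) := by
        rw [← Finset.sum_sub_distrib, Finset.sum_eq_single i]
        · simp
        · intro j _ hj
          simp [Function.update_of_ne hj]
        · simp
      rw [Pi.sub_apply, Function.update_self, form_matrix] at h1
      rw [frobInner_smul_left]
      have h3 : frobInner (η i) (X' - x i) ≤ α * (g X' - g (x i)) := by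
        rw [← h2, mul_sub]
        linarith
      have h4 : α⁻¹ * frobInner (η i) (X' - x i) ≤ α⁻¹ * (α * (g X' - g (x i))) := by gcongr
      rw [inv_mul_cancel_left₀ hα.ne'] at h4
      linarith
    · intro j _ hj
      simp [Function.update_of_ne hj]
    · simp
  · intro h x'
    have h1 : ∀ i, frobInner (η i) (x' i - x i) ≤ α * (g (x' i) - g (x i)) := by
      intro i
      have h2 := h i (x' i)
      rw [frobInner_smul_left] at h2
      calc frobInner (η i) (x' i - x i) = α * (α⁻¹ * frobInner (η i) (x' i - x i)) := by
            rw [mul_inv_cancel_left₀ hα.ne']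
        _ ≤ _ := by gcongr; linarith
    have h3 := Finset.sum_le_sum fun i (_ : i ∈ Finset.univ) => h1 i
    rw [← Finset.mul_sum, Finset.sum_sub_distrib, mul_sub] at h3
    simp only [form_pi, Pi.sub_apply, form_matrix]
    linarith

theorem convexOn_sum (hα : 0 < α) (hg : ConvexOn ℝ univ g) :
    ConvexOn ℝ univ (fun x : Fin n → Matrix κ ι ℝ => α * ∑ i, g (x i)) := by
  have h : ∀ s : Finset (Fin n),
      ConvexOn ℝ univ fun x : Fin n → Matrix κ ι ℝ => ∑ i ∈ s, g (x i) := by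
    intro s
    refine ⟨convex_univ, fun x _ y _ c d hc hd hcd => ?_⟩
    simp only [smul_eq_mul, Finset.mul_sum, ← Finset.sum_add_distrib]
    exact Finset.sum_le_sum fun i _ => hg.2 (mem_univ (x i)) (mem_univ (y i)) hc hd hcd
  exact (h Finset.univ).smul hα.le

end Subdifferential

/-! ### First-order optimality for the regularized objective. -/

section Optimality

variable {n : ℕ} {m r : Fin n → ℕ} (A : Matrix (Idx m) (Idx m) ℝ) (B : Matrix (Idx r) (Idx r) ℝ)
  (C : Matrix (Idx m) (Idx r) ℝ)

/-- The gradient of `½ ‖A X + X B - C‖²`. -/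
noncomputable def residualGradient (X : Matrix (Idx m) (Idx r) ℝ) : Matrix (Idx m) (Idx r) ℝ :=
  A.transpose * (A * X + X * B - C) + (A * X + X * B - C) * B.transpose

theorem half_sq_norm_residual_add (X D : Matrix (Idx m) (Idx r) ℝ) :
    1 / 2 * ‖A * (X + D) + (X + D) * B - C‖ ^ 2 = 1 / 2 * ‖A * X + X * B - C‖ ^ 2
      + frobInner (residualGradient A B C X) D + 1 / 2 * ‖A * D + D * B‖ ^ 2 := by
  have h : A * (X + D) + (X + D) * B - C = (A * X + X * B - C) + (A * D + D * B) := by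
    rw [Matrix.mul_add, Matrix.add_mul]
    abel
  rw [h, residualGradient]
  set Θ := A * X + X * B - C
  simp only [← frobInner_self_eq_sq_norm, frobInner_add_left, frobInner_add_right]
  have h1 := frobInner_mul_left A D Θ
  have h2 := frobInner_mul_right D B Θ
  have h3 := frobInner_comm D (A.transpose * Θ)
  have h4 := frobInner_comm D (Θ * B.transpose)
  have h5 := frobInner_comm Θ (A * D)
  have h6 := frobInner_comm Θ (D * B)
  linarith

theorem isMinOn_of_neg_gradient_mem {β : ℝ} (hβ : 0 < β) {g : Matrix (Idx m) (Idx r) ℝ → ℝ}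
    {X h : Matrix (Idx m) (Idx r) ℝ} (hh : h ∈ subdiff g X)
    (h0 : residualGradient A B C X + β • h = 0) :
    IsMinOn (regObjective A B C β g) univ X := by
  rw [isMinOn_univ_iff]
  intro X'
  have h1 := half_sq_norm_residual_add A B C X (X' - X)
  rw [add_sub_cancel] at h1
  have h2 := mul_le_mul_of_nonneg_left (hh X') hβ.le
  have h3 : frobInner (residualGradient A B C X) (X' - X) + β * frobInner h (X' - X) = 0 := by
    rw [← frobInner_smul_left, ← frobInner_add_left, h0, ← form_matrix, map_zero, zero_apply]
  have h4 := sq_nonneg ‖A * (X' - X) + (X' - X) * B‖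
  simp only [regObjective]
  linarith

theorem neg_gradient_mem_subdiff {β : ℝ} (hβ : 0 < β) {g : Matrix (Idx m) (Idx r) ℝ → ℝ}
    (hg : ConvexOn ℝ univ g) {X : Matrix (Idx m) (Idx r) ℝ}
    (hX : IsMinOn (regObjective A B C β g) univ X) :
    -(β⁻¹ • residualGradient A B C X) ∈ subdiff g X := by
  intro X'
  set D := X' - X with hD
  set q := 1 / 2 * ‖A * D + D * B‖ ^ 2 with hq
  set p := frobInner (residualGradient A B C X) D with hp
  -- Minimality is compared with the segment point `X + t • D`, where convexity bounds `g`; dividing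
  -- by `t` leaves the quadratic term with a factor `t` that disappears in the limit.
  have key : ∀ t : ℝ, 0 < t → t ≤ 1 → 0 ≤ p + t * q + β * (g X' - g X) := by
    intro t ht ht1
    have h1 := isMinOn_univ_iff.1 hX (X + t • D)
    simp only [regObjective] at h1
    rw [half_sq_norm_residual_add, frobInner_smul_right, Matrix.mul_smul, Matrix.smul_mul,
      ← smul_add, norm_smul, mul_pow, Real.norm_eq_abs, sq_abs] at h1
    have h2 := hg.2 (mem_univ X) (mem_univ X') (sub_nonneg.2 ht1) ht.le (by ring)
    rw [show (1 - t) • X + t • X' = X + t • D by rw [hD]; module] at h2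
    simp only [smul_eq_mul] at h2
    have h3 := mul_le_mul_of_nonneg_left h2 hβ.le
    have h4 : 0 ≤ t * (p + t * q + β * (g X' - g X)) := by
      rw [hq, hp]
      linarith
    exact nonneg_of_mul_nonneg_right h4 ht
  have hlim : 0 ≤ p + β * (g X' - g X) := by
    have h1 : Tendsto (fun t : ℝ => p + t * q + β * (g X' - g X)) (𝓝[>] 0)
        (𝓝 (p + 0 * q + β * (g X' - g X))) := by
      apply Tendsto.mono_left _ nhdsWithin_le_nhds
      exact Continuous.tendsto (by fun_prop) _
    rw [zero_mul, add_zero] at h1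
    refine ge_of_tendsto h1 ?_
    filter_upwards [Ioc_mem_nhdsGT (zero_lt_one' ℝ)] with t ht
    exact key t ht.1 ht.2
  have h5 : frobInner (-(β⁻¹ • residualGradient A B C X)) D = -(β⁻¹ * p) := by
    rw [← smul_neg, frobInner_smul_left, ← form_matrix, map_neg, neg_apply, form_matrix]
    ring
  rw [h5]
  have h6 : 0 ≤ β⁻¹ * (p + β * (g X' - g X)) := by positivity
  rw [mul_add, inv_mul_cancel_left₀ hβ.ne'] at h6
  linarith

end Optimality

/-! ### Blockwise multiplication operators and their adjoints. -/

section BlockOperators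

variable {n : ℕ} {κ ι κ' ι' : Fin n → Type*} [∀ i, Fintype (κ i)] [∀ i, Fintype (ι i)]
  [∀ i, Fintype (κ' i)] [∀ i, Fintype (ι' i)]

/-- Multiplying every member of a family of matrices on the left. -/
noncomputable def leftMul (M : ∀ i, Matrix (κ' i) (κ i) ℝ) :
    (∀ i, Matrix (κ i) (ι i) ℝ) →L[ℝ] (∀ i, Matrix (κ' i) (ι i) ℝ) :=
  LinearMap.toContinuousLinearMap
    { toFun := fun U i => M i * U i
      map_add' := fun U W => by ext1 i; exact Matrix.mul_add _ _ _
      map_smul' := fun c U => by ext1 i; exact Matrix.mul_smul (M i) c (U i) }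

theorem leftMul_apply (M : ∀ i, Matrix (κ' i) (κ i) ℝ) (U : ∀ i, Matrix (κ i) (ι i) ℝ) (i : Fin n) :
    leftMul M U i = M i * U i := rfl

theorem form_leftMul (M : ∀ i, Matrix (κ' i) (κ i) ℝ) (U : ∀ i, Matrix (κ i) (ι i) ℝ)
    (W : ∀ i, Matrix (κ' i) (ι i) ℝ) :
    form (leftMul M U) W = form U (leftMul (fun i => (M i).transpose) W) := by
  simp only [form_pi, form_matrix, leftMul_apply, frobInner_mul_left]

/-- Multiplying every member of a family of matrices on the right. -/
noncomputable def rightMul (M : ∀ i, Matrix (ι i) (ι' i) ℝ) :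
    (∀ i, Matrix (κ i) (ι i) ℝ) →L[ℝ] (∀ i, Matrix (κ i) (ι' i) ℝ) :=
  LinearMap.toContinuousLinearMap
    { toFun := fun U i => U i * M i
      map_add' := fun U W => by ext1 i; exact Matrix.add_mul _ _ _
      map_smul' := fun c U => by ext1 i; exact Matrix.smul_mul c (U i) (M i) }

theorem rightMul_apply (M : ∀ i, Matrix (ι i) (ι' i) ℝ) (U : ∀ i, Matrix (κ i) (ι i) ℝ)
    (i : Fin n) : rightMul M U i = U i * M i := rfl

theorem form_rightMul (M : ∀ i, Matrix (ι i) (ι' i) ℝ) (U : ∀ i, Matrix (κ i) (ι i) ℝ)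
    (W : ∀ i, Matrix (κ i) (ι' i) ℝ) :
    form (rightMul M U) W = form U (rightMul (fun i => (M i).transpose) W) := by
  simp only [form_pi, form_matrix, rightMul_apply, frobInner_mul_right]

end BlockOperators

/-! ### The Sylvester flow and its equilibria. -/

section Flow

variable {n : ℕ} {m r : Fin n → ℕ} (A : Matrix (Idx m) (Idx m) ℝ) (B : Matrix (Idx r) (Idx r) ℝ)
  (C : Matrix (Idx m) (Idx r) ℝ) {a : Matrix (Fin n) (Fin n) ℝ}

/-- The saddle-point operators of the distributed Sylvester equation. -/
noncomputable def sylvesterOperators (ha : IsUndirectedWeight a) :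
    SaddleOperators (Fin n → Matrix (Idx m) (Idx r) ℝ) ((i : Fin n) → Matrix (Fin (m i)) (Idx r) ℝ)
      ((i : Fin n) → Matrix (Idx m) (Fin (r i)) ℝ) where
  A := leftMul fun i => rowBlock i A
  A' := leftMul fun i => (rowBlock i A).transpose
  form_A := form_leftMul _
  B := rightMul fun i => colBlock i B
  B' := rightMul fun i => (colBlock i B).transpose
  form_B := form_rightMul _
  R := leftMul fun i => colPad i (1 : Matrix (Fin (m i)) (Fin (m i)) ℝ)
  R' := leftMul fun i => (colPad i (1 : Matrix (Fin (m i)) (Fin (m i)) ℝ)).transpose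
  form_R := form_leftMul _
  S := rightMul fun i => rowPad i (1 : Matrix (Fin (r i)) (Fin (r i)) ℝ)
  S' := rightMul fun i => (rowPad i (1 : Matrix (Fin (r i)) (Fin (r i)) ℝ)).transpose
  form_S := form_rightMul _
  L := LinearMap.toContinuousLinearMap (disagreementₗ a)
  form_L x y := by
    simp only [form_pi, form_matrix]
    exact sum_frobInner_disagreement_comm ha x y
  form_L_nonneg x := by
    simp only [form_pi, form_matrix]
    change 0 ≤ ∑ i, frobInner (x i) (disagreement a x i)
    rw [← sum_frobInner_disagreement_comm ha x x, sum_frobInner_disagreement ha]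
    have : 0 ≤ ∑ i, ∑ j, a i j * frobInner (x i - x j) (x i - x j) :=
      Finset.sum_nonneg fun i _ => Finset.sum_nonneg fun j _ =>
        mul_nonneg (ha.nonneg i j) (frobInner_self_nonneg _)
    linarith

theorem regField_eq_field (ha : IsUndirectedWeight a) {α : ℝ} (hα : 0 < α)
    (g : Matrix (Idx m) (Idx r) ℝ → ℝ) :
    regField A B C a α g = (sylvesterOperators A B ha).field (fun i => colBlock i C)
      (fun x => α * ∑ i, g (x i)) := by
  ext P V
  obtain ⟨x, y, z, w, l, u, θ⟩ := P
  obtain ⟨x', y', z', w', l', u', θ'⟩ := V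
  have hR (i : Fin n) : (colPad i (1 : Matrix (Fin (m i)) (Fin (m i)) ℝ)).transpose * y i
      = rowPad i (y i) := by
    rw [transpose_colPad, Matrix.transpose_one, rowPad_one_mul]
  have hS (i : Fin n) : z i * (rowPad i (1 : Matrix (Fin (r i)) (Fin (r i)) ℝ)).transpose
      = colPad i (z i) := by
    rw [transpose_rowPad, Matrix.transpose_one, mul_colPad_one]
  constructor
  · intro h
    choose η hη h1 using fun i => (h i).1
    -- The weight `α` is absorbed into the abstract penalty, so abstract subgradients are `α` times
    -- those of `g`.
    refine ⟨fun i => α • η i, (mem_formSubdiff_sum hα).2 fun i => ?_, ?_, ?_, ?_, ?_, ?_, ?_, ?_⟩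
    · rw [inv_smul_smul₀ hα.ne']
      exact hη i
    · funext i
      exact h1 i
    · funext i; exact (h i).2.1
    · funext i; exact (h i).2.2.1
    · funext i; exact (h i).2.2.2.1
    · funext i; exact (h i).2.2.2.2.1
    · funext i; exact (h i).2.2.2.2.2.1
    · funext i
      refine (h i).2.2.2.2.2.2.trans ?_
      change rowPad i (y i) - colPad i (z i) - _ - _ = _
      rw [← hR, ← hS]
      rfl
  · rintro ⟨η, hη, h1, h2, h3, h4, h5, h6, h7⟩ i
    refine ⟨⟨α⁻¹ • η i, (mem_formSubdiff_sum hα).1 hη i, ?_⟩, congrFun h2 i, congrFun h3 i,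
      congrFun h4 i, congrFun h5 i, congrFun h6 i, ?_⟩
    · refine (congrFun h1 i).trans ?_
      rw [smul_inv_smul₀ hα.ne']
      rfl
    · refine (congrFun h7 i).trans ?_
      change _ = rowPad i (y i) - colPad i (z i) - _ - _
      rw [← hR, ← hS]
      rfl

variable {g : Matrix (Idx m) (Idx r) ℝ → ℝ} {α : ℝ}

theorem exists_isEquilibrium (ha : IsUndirectedWeight a) (hconn : (weightGraph a).Connected)
    (hα : 0 < α) (hg : ConvexOn ℝ univ g)
    (hmin : ∃ X₀, IsMinOn (regObjective A B C (n * α) g) univ X₀) :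
    ∃ Q, IsEquilibrium (regField A B C a α g) Q := by
  obtain ⟨X, hX⟩ := hmin
  obtain ⟨i₀⟩ := hconn.nonempty
  have hn : (0 : ℝ) < n := by exact_mod_cast i₀.pos
  have hβ : 0 < n * α := by positivity
  have hh := neg_gradient_mem_subdiff A B C hβ hg hX
  set h := -((n * α)⁻¹ • residualGradient A B C X) with hdef
  set Θ := A * X + X * B - C with hΘ
  have hgrad : (n : ℝ) • (α • h) = -residualGradient A B C X := by
    rw [hdef, smul_smul, smul_neg, smul_inv_smul₀ hβ.ne']
  -- Zero sum holds because the row blocks and the column blocks both reassemble `A * X`.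
  obtain ⟨W, hW⟩ := exists_disagreement_eq ha hconn
    (R := fun i => rowPad i (rowBlock i (A * X)) - colPad i (colBlock i (A * X))) (by
      rw [Finset.sum_sub_distrib, sum_rowPad_rowBlock, sum_colPad_colBlock, sub_self])
  -- Zero sum is here exactly the stationarity condition `hgrad`; the same subgradient `h` serves
  -- every agent.
  obtain ⟨Λ, hΛ⟩ := exists_disagreement_eq ha hconn
    (R := fun i => -(colBlock i Θ * (colBlock i B).transpose) - α • h
      - (rowBlock i A).transpose * rowBlock i Θ) (by
      rw [Finset.sum_sub_distrib, Finset.sum_sub_distrib, Finset.sum_neg_distrib,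
        sum_colBlock_mul_transpose, sum_transpose_rowBlock_mul, Finset.sum_const,
        Finset.card_univ, Fintype.card_fin, ← Nat.cast_smul_eq_nsmul ℝ, hgrad, residualGradient]
      abel)
  refine ⟨(fun _ => X, fun i => rowBlock i (A * X), fun i => colBlock i (A * X), W, Λ,
    fun i => rowBlock i Θ, fun _ => Θ), fun i => ⟨⟨h, hh, ?_⟩, ?_, ?_, ?_, ?_, ?_, ?_⟩⟩
  · change 0 = -((X * colBlock i B - colBlock i C + colBlock i (A * X)) * (colBlock i B).transpose)
      - α • h - (rowBlock i A).transpose * rowBlock i Θ - disagreement a Λ i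
      - (rowBlock i A).transpose * (rowBlock i A * X - rowBlock i (A * X))
      - disagreement a (fun _ => X) i
    have h1 : X * colBlock i B - colBlock i C + colBlock i (A * X) = colBlock i Θ := by
      ext p k
      simp only [hΘ, mul_colBlock, colBlock, Matrix.add_apply, Matrix.sub_apply]
      ring
    rw [h1, hΛ, disagreement_const, rowBlock_mul, sub_self (rowBlock i (A * X)), Matrix.mul_zero]
    abel
  · change 0 = rowBlock i Θ - colPad i (1 : Matrix (Fin (m i)) (Fin (m i)) ℝ) * Θ
      + rowBlock i A * (X - 0) - rowBlock i (A * X)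
    rw [colPad_one_mul, sub_zero, rowBlock_mul]
    abel
  · change 0 = -((X - 0) * colBlock i B - colBlock i C + colBlock i (A * X))
      + Θ * rowPad i (1 : Matrix (Fin (r i)) (Fin (r i)) ℝ)
    rw [mul_rowPad_one, sub_zero]
    ext p k
    simp only [hΘ, mul_colBlock, colBlock, Matrix.add_apply, Matrix.sub_apply, Matrix.neg_apply,
      Matrix.zero_apply]
    ring
  · exact (disagreement_const Θ i).symm
  · change 0 = disagreement a (fun _ => X) i + disagreement a (fun _ => 0) i
    rw [disagreement_const, disagreement_const, add_zero]
  · change 0 = rowBlock i A * (X + 0) - rowBlock i (A * X)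
    rw [add_zero, rowBlock_mul, sub_self]
  · change 0 = rowPad i (rowBlock i (A * X)) - colPad i (colBlock i (A * X)) - disagreement a W i
      - disagreement a (fun _ => Θ) i
    rw [hW, disagreement_const, sub_self, sub_zero]

theorem exists_isMinOn_of_isEquilibrium (ha : IsUndirectedWeight a)
    (hconn : (weightGraph a).Connected) (hα : 0 < α) {Q : State m r}
    (hQ : IsEquilibrium (regField A B C a α g) Q) :
    ∃ X, IsMinOn (regObjective A B C (n * α) g) univ X ∧ ∀ i, State.X Q i = X := by
  obtain ⟨i₀⟩ := hconn.nonempty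
  have hn : (0 : ℝ) < n := by exact_mod_cast i₀.pos
  have hβ : 0 < n * α := by positivity
  obtain ⟨x, y, z, w, l, u, θ⟩ := Q
  choose h hh e1 using fun i => (hQ i).1
  have e2 (i : Fin n) : 0 = u i - colPad i (1 : Matrix (Fin (m i)) (Fin (m i)) ℝ) * θ i
      + rowBlock i A * (x i - 0) - y i := (hQ i).2.1
  have e3 (i : Fin n) : 0 = -((x i - 0) * colBlock i B - colBlock i C + z i)
      + θ i * rowPad i (1 : Matrix (Fin (r i)) (Fin (r i)) ℝ) := (hQ i).2.2.1
  have e4 (i : Fin n) : 0 = disagreement a θ i := (hQ i).2.2.2.1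
  have e5 (i : Fin n) : 0 = disagreement a x i + disagreement a (fun _ => 0) i :=
    (hQ i).2.2.2.2.1
  have e6 (i : Fin n) : 0 = rowBlock i A * (x i + 0) - y i := (hQ i).2.2.2.2.2.1
  have e7 (i : Fin n) : 0 = rowPad i (y i) - colPad i (z i) - disagreement a w i
    - disagreement a θ i := (hQ i).2.2.2.2.2.2
  replace e1 (i : Fin n) : 0 = -((x i * colBlock i B - colBlock i C + z i)
      * (colBlock i B).transpose) - α • h i - (rowBlock i A).transpose * u i - disagreement a l i
      - (rowBlock i A).transpose * (rowBlock i A * x i - y i) - disagreement a x i := e1 i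
  have hLx (i : Fin n) : disagreement a x i = 0 := by
    have := e5 i
    rw [disagreement_const, add_zero] at this
    exact this.symm
  have hx := fun i => eq_of_disagreement_eq_zero ha hconn hLx i i₀
  have hθ := fun i => eq_of_disagreement_eq_zero ha hconn (fun i => (e4 i).symm) i i₀
  set X := x i₀ with hXdef
  set Θ := θ i₀ with hΘdef
  have hy (i : Fin n) : y i = rowBlock i (A * X) := by
    have := e6 i
    rw [add_zero, hx i, rowBlock_mul] at this
    exact (sub_eq_zero.1 this.symm).symm
  have hu (i : Fin n) : u i = rowBlock i Θ := by
    have := e2 i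
    rw [sub_zero, hx i, hθ i, hy i, rowBlock_mul, add_sub_cancel_right, colPad_one_mul] at this
    exact sub_eq_zero.1 this.symm
  -- Summing over the agents kills the Laplacian terms, so the distributed row and column splittings
  -- describe the same matrix.
  have hAX : A * X = ∑ i, colPad i (z i) := by
    have h1 : ∑ i, (rowPad i (y i) - colPad i (z i) - disagreement a w i - disagreement a θ i)
      = 0 := Finset.sum_eq_zero fun i _ => (e7 i).symm
    rw [Finset.sum_sub_distrib, Finset.sum_sub_distrib, Finset.sum_sub_distrib,
      sum_disagreement ha, sum_disagreement ha, sub_zero, sub_zero] at h1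
    simp only [hy, sum_rowPad_rowBlock] at h1
    exact sub_eq_zero.1 h1
  have hz (i : Fin n) : z i = colBlock i (A * X) := by rw [hAX, colBlock_sum_colPad]
  have hcol (i : Fin n) : X * colBlock i B - colBlock i C + z i = colBlock i Θ := by
    have := e3 i
    rw [sub_zero, hx i, hθ i, mul_rowPad_one, neg_add_eq_sub] at this
    exact (sub_eq_zero.1 this.symm).symm
  have hres : A * X + X * B - C = Θ := by
    refine eq_of_colBlock_eq fun i => ?_
    rw [← hcol i, hz i]
    ext p k
    simp only [mul_colBlock, colBlock, Matrix.add_apply, Matrix.sub_apply]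
    ring
  have hsum : residualGradient A B C X + α • ∑ i, h i = 0 := by
    have h1 : ∑ i, (-(colBlock i Θ * (colBlock i B).transpose) - α • h i
        - (rowBlock i A).transpose * rowBlock i Θ - disagreement a l i) = 0 := by
      refine Finset.sum_eq_zero fun i _ => ?_
      have := e1 i
      rw [hLx i, hx i, hcol i, hu i, hy i, rowBlock_mul, sub_self, Matrix.mul_zero, sub_zero,
        sub_zero] at this
      exact this.symm
    rw [Finset.sum_sub_distrib, Finset.sum_sub_distrib, Finset.sum_sub_distrib,
      Finset.sum_neg_distrib, sum_colBlock_mul_transpose, sum_transpose_rowBlock_mul,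
      sum_disagreement ha, sub_zero, ← Finset.smul_sum] at h1
    rw [residualGradient, hres, ← neg_eq_zero, ← h1]
    abel
  refine ⟨X, ?_, hx⟩
  -- The agents may use different subgradients at the common point `X`; their average is again a
  -- subgradient, and its weight `n * α` matches the sum.
  refine isMinOn_of_neg_gradient_mem A B C hβ (h := (n : ℝ)⁻¹ • ∑ i, h i) ?_ ?_
  · intro X'
    have h1 : ∀ i ∈ Finset.univ, frobInner (h i) (X' - X) ≤ g X' - g X := by
      intro i _
      have := hh i X'
      have h2 : State.X ((x, y, z, w, l, u, θ) : State m r) i = X := hx i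
      rw [h2] at this
      linarith
    have h2 := Finset.sum_le_sum h1
    rw [Finset.sum_const, Finset.card_univ, Fintype.card_fin, nsmul_eq_mul] at h2
    rw [frobInner_smul_left, frobInner_sum_left]
    have h3 := mul_le_mul_of_nonneg_left h2 (inv_nonneg.2 hn.le)
    rw [inv_mul_cancel_left₀ hn.ne'] at h3
    linarith
  · rw [mul_comm, mul_smul, smul_inv_smul₀ hn.ne', hsum]

end Flow

theorem theorem3 {n : ℕ} (m r : Fin n → ℕ)
    (A : Matrix (Idx m) (Idx m) ℝ) (B : Matrix (Idx r) (Idx r) ℝ) (C : Matrix (Idx m) (Idx r) ℝ)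
    (a : Matrix (Fin n) (Fin n) ℝ) (ha : IsUndirectedWeight a) (hconn : (weightGraph a).Connected)
    (α : ℝ) (hα : 0 < α)
    (g : Matrix (Idx m) (Idx r) ℝ → ℝ) (hg : ConvexOn ℝ Set.univ g)
    (hmin : ∃ X₀, IsMinOn (regObjective A B C (n * α) g) Set.univ X₀) :
    (∀ z, IsEquilibrium (regField A B C a α g) z → IsLyapunovStable (regField A B C a α g) z) ∧
    (∀ P, IsSolution (regField A B C a α g) P → Bornology.IsBounded (P '' Set.Ici 0)) ∧
    IsGloballySemistable (regField A B C a α g) ∧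
    (∀ P, IsSolution (regField A B C a α g) P →
      ∃ Xlim, IsMinOn (regObjective A B C (n * α) g) Set.univ Xlim ∧
        ∀ i, Filter.Tendsto (fun t => State.X (P t) i) Filter.atTop (nhds Xlim)) := by
  have hex := exists_isEquilibrium A B C ha hconn hα hg hmin
  have hopt := fun Q => exists_isMinOn_of_isEquilibrium A B C (g := g) ha hconn hα (Q := Q)
  have hG := convexOn_sum (n := n) hα hg
  rw [regField_eq_field A B C ha hα g] at *
  refine ⟨fun z hz => SaddleOperators.isLyapunovStable hG hz,
    fun P hP => SaddleOperators.isBounded_of_isSolution hG hex hP, fun P hP _ => ?_,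
    fun P hP => ?_⟩
  · obtain ⟨Q, hQ, hlim⟩ := SaddleOperators.exists_tendsto_equilibrium hG hex hP
    exact ⟨Q, SaddleOperators.isLyapunovStable hG hQ, hlim⟩
  · obtain ⟨Q, hQ, hlim⟩ := SaddleOperators.exists_tendsto_equilibrium hG hex hP
    obtain ⟨X, hX, hXQ⟩ := hopt Q hQ
    refine ⟨X, hX, fun i => ?_⟩
    rw [← hXQ i]
    exact (((continuous_apply i).comp continuous_fst).tendsto Q).comp hlim
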